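/- There is a deterministic polynomial-time algorithm that, for every $d$, is a $\frac{d+1}{2}$-approximation algorithm for Max 2-CSP on $d$-bounded-degree instances. In detail: a 2-CSP instance $\Pi$ consists of a finite simple graph $G=(V,E)$ (the constraint graph), a nonempty finite alphabet $\Sigma_v$ for each $v\in V$, and a constraint $R_e\subseteq\Sigma_u\times\Sigma_v$ for each edge $e=(u,v)\in E$. An assignment is a tuple $\psi=(\psi_v)_{v\in V}$ with $\psi_v\in\Sigma_v$; its value $\mathrm{val}_\Pi(\psi)$ is the fraction of the edges $e=(u,v)\in E$ with $(\psi_u,\psi_v)\in R_e$ (and $0$ if $E=\emptyset$), and $\mathrm{val}(\Pi)=\max_\psi\mathrm{val}_\Pi(\psi)$. Instances are given to the algorithm explicitly, with all alphabets listed and each constraint given by its truth table. Then there are an algorithm and a polynomial $q$ such that for every integer $d\ge 0$ and every 2-CSP instance $\Pi$ whose constraint graph has maximum degree at most $d$, the algorithm on input $\Pi$ halts after at most $q(N)$ steps, where $N$ is the length of the encoding of $\Pi$, and outputs an assignment $\psi$ with $$\mathrm{val}(\Pi)\;\le\;\frac{d+1}{2}\cdot\mathrm{val}_\Pi(\psi).$$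 -/

import Mathlib

/-! ## Max 2-CSP -/

/-- A 2-CSP instance with variable set `V` and alphabets `A v`: a (simple) constraint graph and,
for each edge `{u, v}`, a constraint, i.e. a subset of `A u × A v`. As edges are unordered, the
constraint is given for both orientations of the edge, one being the transpose of the other. -/
structure TwoCSP (V : Type*) (A : V → Type*) where
  graph : SimpleGraph V
  rel : ∀ {u v : V}, graph.Adj u v → Set (A u × A v)
  rel_symm : ∀ {u v : V} (h : graph.Adj u v) (a : A u) (b : A v),
    (a, b) ∈ rel h ↔ (b, a) ∈ rel h.symm

namespace TwoCSP

variable {V : Type*} {A : V → Type*}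

/-- The set of edges whose constraint is satisfied by the assignment `ψ`. -/
def satisfied (I : TwoCSP V A) (ψ : ∀ v, A v) : Set (Sym2 V) :=
  {e | ∃ (u v : V) (h : I.graph.Adj u v), e = s(u, v) ∧ (ψ u, ψ v) ∈ I.rel h}

/-- The value of an assignment: the fraction of the edges that it satisfies
(`0` if there are no edges). Meant for finite `V`. -/
noncomputable def assignmentVal (I : TwoCSP V A) (ψ : ∀ v, A v) : ℝ :=
  ((I.satisfied ψ).ncard : ℝ) / (I.graph.edgeSet.ncard : ℝ)

/-- The value of the instance: the maximum of the values of all assignments. -/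
noncomputable def val (I : TwoCSP V A) : ℝ :=
  ⨆ ψ : (∀ v, A v), I.assignmentVal ψ

/-- Every vertex of the constraint graph has degree at most `d`. -/
def IsBoundedDegree (I : TwoCSP V A) (d : ℕ) : Prop :=
  ∀ v, (I.graph.neighborSet v).encard ≤ (d : ℕ∞)

/-! ### Instances as bit strings -/

/-- `m` ones followed by a zero. -/
def unary (m : ℕ) : List Bool := List.replicate m true ++ [false]

open Classical in
/-- The block of a pair `u, v` of variables: `0` if it is not an edge, and otherwise `1` followed
by the truth table of the constraint, row by row. -/
noncomputable def encodePair {n : ℕ} {k : Fin n → ℕ} (I : TwoCSP (Fin n) (fun v => Fin (k v)))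
    (u v : Fin n) : List Bool :=
  if h : I.graph.Adj u v then
    true :: (List.finRange (k u)).flatMap fun a =>
      (List.finRange (k v)).map fun b => decide ((a, b) ∈ I.rel h)
  else [false]

/-- The bit string that represents an instance with variables `0, …, n - 1` and alphabets
`{0, …, k v - 1}`: the number of variables, the alphabet sizes (the alphabets being listed
explicitly, a size takes as many bits as there are letters), and the blocks of all pairs
`u < v` in lexicographic order. -/
noncomputable def encode {n : ℕ} {k : Fin n → ℕ} (I : TwoCSP (Fin n) (fun v => Fin (k v))) :
    List Bool :=
  unary n ++ (List.finRange n).flatMap (fun v => unary (k v)) ++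
    (List.finRange n).flatMap fun u =>
      (List.finRange n).flatMap fun v => if u < v then encodePair I u v else []

end TwoCSP

/-! ## Random access machine programs and their running time

Structured programs for a machine whose memory consists of finitely many (those which the program
names) unbounded arrays of natural numbers, accessible at computed indices. The arithmetic
operations are addition and truncated subtraction, each at unit cost. There is no multiplication,
so that in `t` steps the length of a number grows by at most `t` bits, and polynomial time is
polynomial time on Turing machines. -/

namespace RAM

/-- Memory contents: `s a i` is the content of cell `i` of array `a`. -/
abbrev Memory : Type := ℕ → ℕ → ℕ

/-- Expressions; `get a i` reads the cell with index `i` of array `a`. -/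
inductive Expr : Type
  | lit (m : ℕ) : Expr
  | get (a : ℕ) (i : Expr) : Expr
  | add (e f : Expr) : Expr
  | sub (e f : Expr) : Expr

namespace Expr

/-- The value of an expression (`sub` is truncated subtraction). -/
def eval (s : Memory) : Expr → ℕ
  | lit m => m
  | get a i => s a (i.eval s)
  | add e f => e.eval s + f.eval s
  | sub e f => e.eval s - f.eval s

/-- The number of steps for evaluating an expression: one for each of its nodes. -/
def cost : Expr → ℕ
  | lit _ => 1
  | get _ i => i.cost + 1
  | add e f => e.cost + f.cost + 1
  | sub e f => e.cost + f.cost + 1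

end Expr

/-- Programs: `set a i e` writes the value of `e` to cell `i` of array `a`; `ite e p q` runs `p`
if `e` is nonzero and `q` otherwise; `loop e p` runs `p` as long as `e` is nonzero. -/
inductive Prog : Type
  | skip : Prog
  | set (a : ℕ) (i e : Expr) : Prog
  | seq (p q : Prog) : Prog
  | ite (e : Expr) (p q : Prog) : Prog
  | loop (e : Expr) (p : Prog) : Prog

/-- The memory after the value `x` is written to cell `i` of array `a`. -/
def Memory.write (s : Memory) (a i x : ℕ) : Memory :=
  Function.update s a (Function.update (s a) i x)

/-- `Exec p s t s'`: started on the memory `s`, the program `p` halts after exactly `t` steps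
with memory `s'`. -/
inductive Exec : Prog → Memory → ℕ → Memory → Prop
  | skip (s : Memory) : Exec Prog.skip s 1 s
  | set (a : ℕ) (i e : Expr) (s : Memory) :
      Exec (Prog.set a i e) s (i.cost + e.cost + 1) (s.write a (i.eval s) (e.eval s))
  | seq {p q : Prog} {s s' s'' : Memory} {t t' : ℕ} :
      Exec p s t s' → Exec q s' t' s'' → Exec (Prog.seq p q) s (t + t') s''
  | ite_true {e : Expr} {p : Prog} (q : Prog) {s s' : Memory} {t : ℕ} :
      e.eval s ≠ 0 → Exec p s t s' → Exec (Prog.ite e p q) s (e.cost + 1 + t) s'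
  | ite_false {e : Expr} (p : Prog) {q : Prog} {s s' : Memory} {t : ℕ} :
      e.eval s = 0 → Exec q s t s' → Exec (Prog.ite e p q) s (e.cost + 1 + t) s'
  | loop_done {e : Expr} (p : Prog) {s : Memory} :
      e.eval s = 0 → Exec (Prog.loop e p) s (e.cost + 1) s
  | loop_step {e : Expr} {p : Prog} {s s' s'' : Memory} {t t' : ℕ} :
      e.eval s ≠ 0 → Exec p s t s' → Exec (Prog.loop e p) s' t' s'' →
      Exec (Prog.loop e p) s (e.cost + 1 + t + t') s''

/-- The initial memory on the input bit string `x`: cell `0` of array `0` holds the length of `x`,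
the cells `1, 2, …` of array `0` hold its bits, and all other cells are `0`. -/
def input (x : List Bool) : Memory
  | 0, 0 => x.length
  | 0, i + 1 => (x.getD i false).toNat
  | _ + 1, _ => 0

/-- The output: the list of the numbers in the cells `1, 2, …` of array `1`, whose length is
in cell `0` of array `1`. -/
def output (s : Memory) : List ℕ :=
  List.ofFn fun i : Fin (s 1 0) => s 1 (i + 1)

/-- On the input `x`, the program `p` halts within `T` steps with output `y`. -/
def OutputsWithin (p : Prog) (x : List Bool) (T : ℕ) (y : List ℕ) : Prop :=
  ∃ (t : ℕ) (s : Memory), Exec p (input x) t s ∧ t ≤ T ∧ output s = y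

end RAM

/-! Replace each edge by its two opposite arcs. Colour the arcs greedily so that arcs with the same
tail get different colours and so do opposite arcs. When an arc leaving `u` is coloured, at most
`deg u - 1` other arcs out of `u` and one reverse arc forbid a colour, so colours up to `deg u + 1 ≤
d + 1` suffice (`exists_free_colour`, `colourArcs_spec`).

In one colour class every vertex has at most one outgoing arc, so the class is the graph of a
function, up to fixed points: a pseudoforest. There Max 2-CSP can be solved exactly. Cut each cycle
at its largest vertex, the root, fix the value of the root, and run a dynamic program towards it.
Let `ψ` be optimal for a class and `φ` arbitrary. Then `classValue φ ≤ classValue ψ`, and `2 *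
classValue ψ ≤ arcValue ψ`, because the reverse of a satisfied arc is satisfied and lies outside the
class (`two_mul_classValue_le`). Every arc has exactly one colour, so summing over at most `d + 1`
colours gives `2 * arcValue φ ≤ (d + 1) * best`, where `best` is the largest `arcValue` found
(`treatColours_spec`). Since `arcValue` is twice the number of satisfied edges, this is the ratio
`(d + 1) / 2`. The algorithm never uses `d`.

Optimality of the dynamic program (`arcWeight_le_of_table`) needs no induction along the forest.
Summing the table entries along an assignment and exchanging the order of summation expresses the
weight of the assignment as its root entries minus nonnegative defects, and the defects vanish for
the traced-back assignment. The table itself is computed without a topological order: all entries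
are recomputed `N` times, where `N` is the input length, and after `t` sweeps those of rank less
than `t` are correct (`sweeps`).

For the running time, the algorithm is an ordinary function on states, assembled from operations
with closure lemmas (`CompE`, `CompS`). Each closure lemma yields a machine program with a
polynomial bound, because every loop is truncated at `N` rounds. Correctness then requires that
truncation and index clamping never matter, which follows from `2n < N` and from alphabet sizes
being at most `N`. -/

namespace RAM

/-! ### Programs on bounded three-dimensional arrays

Computations are described by ordinary functions on a state that consists of three-dimensional
arrays, whose indices are clamped to the input length `N`. All loops make at most `N` rounds, so
that everything that is built from the closure properties below runs in polynomial time. -/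

/-- The contents of the three-dimensional arrays. -/
abbrev State : Type := ℕ → ℕ → ℕ → ℕ → ℕ

/-- Reading a cell, with clamped indices. -/
def State.rd (N : ℕ) (σ : State) (a i j k : ℕ) : ℕ := σ a (min i N) (min j N) (min k N)

/-- Writing a cell, with clamped indices. -/
def State.wr (N : ℕ) (σ : State) (a i j k x : ℕ) : State := fun a' i' j' k' =>
  if a' = a ∧ i' = min i N ∧ j' = min j N ∧ k' = min k N then x else σ a' i' j' k'

/-- A sum of at most `N` terms. -/
def sumTo (N b : ℕ) (f : ℕ → ℕ) : ℕ := ∑ i ∈ Finset.range (min b N), f i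

/-- A maximum of at most `N` terms. -/
def supTo (N b : ℕ) (f : ℕ → ℕ) : ℕ := (Finset.range (min b N)).sup f

/-- The state after the rounds `0, …, m - 1` of a loop. -/
def rounds (body : ℕ → State → State) : ℕ → State → State
  | 0, σ => σ
  | m + 1, σ => body m (rounds body m σ)

/-- A loop of at most `N` rounds. -/
def forTo (N b : ℕ) (body : ℕ → State → State) (σ : State) : State := rounds body (min b N) σ

/-- A context: the loop variables in scope and the input word, as functions of an environment. -/
structure Ctx (E : Type) where
  depth : ℕ
  word : E → List Bool
  var : E → ℕ → ℕ

/-- The length of the input word. -/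
def Ctx.N {E : Type} (Γ : Ctx E) (e : E) : ℕ := (Γ.word e).length

/-- The context with one more loop variable. -/
def Ctx.ext {E : Type} (Γ : Ctx E) : Ctx (E × ℕ) where
  depth := Γ.depth + 1
  word p := Γ.word p.1
  var p := Function.update (Γ.var p.1) Γ.depth p.2

/-- The machine array that holds the given three-dimensional array. -/
def phys : ℕ → ℕ
  | 0 => 1
  | a + 1 => a + 6

lemma phys_injective : Function.Injective phys := by
  intro a b h
  cases a <;> cases b <;> simp [phys] at h ⊢
  exact h

lemma phys_spec (a : ℕ) : phys a ≠ 0 ∧ phys a ≠ 2 ∧ phys a ≠ 3 ∧ phys a ≠ 4 ∧ phys a ≠ 5 := by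
  cases a <;> simp [phys]

/-! ### Representation of states in the machine memory -/

variable {E : Type} {Γ : Ctx E}

/-- The machine memory `s` represents the state `σ` in the environment `e`. -/
structure Rep (Γ : Ctx E) (e : E) (σ : State) (s : Memory) : Prop where
  inp : s 0 = input (Γ.word e) 0
  -- The machine cannot multiply, so the multiples needed for addresses are kept in two tables.
  tab₁ : ∀ i ≤ Γ.N e, s 4 i = i * (Γ.N e + 1)
  tab₂ : ∀ i ≤ Γ.N e, s 5 i = i * ((Γ.N e + 1) * (Γ.N e + 1))
  arr : ∀ a i j k, i ≤ Γ.N e → j ≤ Γ.N e → k ≤ Γ.N e →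
    s (phys a) (i * ((Γ.N e + 1) * (Γ.N e + 1)) + j * (Γ.N e + 1) + k) = σ a i j k
  var : ∀ i < Γ.depth, s 3 i = Γ.var e i

/-- `s'` differs from `s` only in temporary cells from `r` on and in loop variables from `l` on. -/
structure Keep (r l : ℕ) (s s' : Memory) : Prop where
  other : ∀ a, a ≠ 2 → a ≠ 3 → s' a = s a
  tmp : ∀ i < r, s' 2 i = s 2 i
  var : ∀ i < l, s' 3 i = s 3 i

lemma Keep.refl (r l : ℕ) (s : Memory) : Keep r l s s :=
  ⟨fun _ _ _ => rfl, fun _ _ => rfl, fun _ _ => rfl⟩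

lemma Keep.trans {r l r' l' : ℕ} {s s' s'' : Memory} (h : Keep r l s s') (h' : Keep r' l' s' s'')
    (hr : r ≤ r') (hl : l ≤ l') : Keep r l s s'' :=
  ⟨fun a h2 h3 => (h'.other a h2 h3).trans (h.other a h2 h3),
   fun i hi => (h'.tmp i (by omega)).trans (h.tmp i hi),
   fun i hi => (h'.var i (by omega)).trans (h.var i hi)⟩

lemma Keep.write_tmp {r l i : ℕ} (s : Memory) (x : ℕ) (h : r ≤ i) : Keep r l s (s.write 2 i x) := by
  refine ⟨fun a h2 _ => by simp [Memory.write, h2], fun j hj => ?_, fun j _ => by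
    simp [Memory.write]⟩
  have : j ≠ i := by omega
  simp [Memory.write, this]

lemma Keep.write_var {r l i : ℕ} (s : Memory) (x : ℕ) (h : l ≤ i) : Keep r l s (s.write 3 i x) := by
  refine ⟨fun a _ h3 => by simp [Memory.write, h3], fun j hj => by simp [Memory.write],
    fun j hj => ?_⟩
  have : j ≠ i := by omega
  simp [Memory.write, this]

lemma Keep.tset {r l i x : ℕ} {s s' : Memory} (h : Keep r l s s') (hi : r ≤ i) :
    Keep r l s (s'.write 2 i x) :=
  h.trans (Keep.write_tmp s' x hi) le_rfl le_rfl

lemma Keep.vset {r l i x : ℕ} {s s' : Memory} (h : Keep r l s s') (hi : l ≤ i) :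
    Keep r l s (s'.write 3 i x) :=
  h.trans (Keep.write_var s' x hi) le_rfl le_rfl

@[simp] lemma write_self (s : Memory) (a i x : ℕ) : s.write a i x a i = x := by
  simp [Memory.write]

lemma write_of_ne {s : Memory} {a i x a' i' : ℕ} (h : a' ≠ a ∨ i' ≠ i) :
    s.write a i x a' i' = s a' i' := by
  by_cases ha : a' = a
  · subst ha
    have : i' ≠ i := by tauto
    simp [Memory.write, this]
  · simp [Memory.write, ha]

lemma Rep.keep {e : E} {σ : State} {s s' : Memory} {r : ℕ} (h : Rep Γ e σ s)
    (hk : Keep r Γ.depth s s') : Rep Γ e σ s' where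
  inp := by rw [hk.other 0 (by simp) (by simp), h.inp]
  tab₁ i hi := by rw [hk.other 4 (by simp) (by simp), h.tab₁ i hi]
  tab₂ i hi := by rw [hk.other 5 (by simp) (by simp), h.tab₂ i hi]
  arr a i j k hi hj hk' := by
    rw [hk.other _ (phys_spec a).2.1 (phys_spec a).2.2.1, h.arr a i j k hi hj hk']
  var i hi := by rw [hk.var i hi, h.var i hi]

lemma Rep.length {e : E} {σ : State} {s : Memory} (h : Rep Γ e σ s) : s 0 0 = Γ.N e := by
  rw [h.inp]; rfl

lemma Rep.ext {e : E} {σ : State} {s : Memory} {i : ℕ} (h : Rep Γ e σ s) (hi : s 3 Γ.depth = i) :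
    Rep Γ.ext (e, i) σ s where
  inp := h.inp
  tab₁ := h.tab₁
  tab₂ := h.tab₂
  arr := h.arr
  var j hj := by
    by_cases hjl : j = Γ.depth
    · subst hjl; simp [Ctx.ext, hi]
    · have : j < Γ.depth := by simp only [Ctx.ext] at hj; omega
      simp [Ctx.ext, hjl, h.var j this]

lemma Rep.of_ext {e : E} {σ : State} {s : Memory} {i : ℕ} (h : Rep Γ.ext (e, i) σ s) :
    Rep Γ e σ s ∧ s 3 Γ.depth = i := by
  refine ⟨⟨h.inp, h.tab₁, h.tab₂, h.arr, fun j hj => ?_⟩, ?_⟩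
  · have := h.var j (Nat.lt_succ_of_lt hj)
    rw [this]; simp [Ctx.ext, hj.ne]
  · rw [h.var _ (Nat.lt_succ_self _)]; simp [Ctx.ext]

/-- `f` is evaluated by a polynomial time program. -/
def CompE (Γ : Ctx E) (f : E → State → ℕ) : Prop :=
  -- The temporary cells form a stack: for each height `r` there is a version of the program that
  -- leaves the cells below `r` alone. The bound depends on the input length only, since arithmetic
  -- has unit cost whatever the size of the numbers.
  ∀ r, ∃ (p : Prog) (q : Polynomial ℕ), ∀ e σ s, Rep Γ e σ s →
    ∃ t s', Exec p s t s' ∧ t ≤ q.eval (Γ.N e) ∧ s' 2 r = f e σ ∧ Keep r Γ.depth s s'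

/-- `F` is performed by a polynomial time program. -/
def CompS (Γ : Ctx E) (F : E → State → State) : Prop :=
  ∀ r, ∃ (p : Prog) (q : Polynomial ℕ), ∀ e σ s, Rep Γ e σ s →
    ∃ t s', Exec p s t s' ∧ t ≤ q.eval (Γ.N e) ∧ Rep Γ e (F e σ) s' ∧ ∀ i < r, s' 2 i = s 2 i

/-- Assignment to the temporary cell `r`. -/
def tset (r : ℕ) (e : Expr) : Prog := Prog.set 2 (Expr.lit r) e

/-- Reading the temporary cell `r`. -/
def tget (r : ℕ) : Expr := Expr.get 2 (Expr.lit r)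

/-- Assignment to the loop variable `l`. -/
def vset (l : ℕ) (e : Expr) : Prog := Prog.set 3 (Expr.lit l) e

/-- Reading the loop variable `l`. -/
def vget (l : ℕ) : Expr := Expr.get 3 (Expr.lit l)

/-- The minimum of `e` and the input length. -/
def clamp (e : Expr) : Expr := Expr.sub e (Expr.sub e (Expr.get 0 (Expr.lit 0)))

@[simp] lemma eval_tget (s : Memory) (r : ℕ) : (tget r).eval s = s 2 r := rfl
@[simp] lemma eval_vget (s : Memory) (r : ℕ) : (vget r).eval s = s 3 r := rfl

lemma eval_clamp {e : Expr} {s : Memory} {N : ℕ} (h : s 0 0 = N) :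
    (clamp e).eval s = min (e.eval s) N := by
  simp only [clamp, Expr.eval, h]; omega

lemma exec_tset (r : ℕ) (e : Expr) (s : Memory) :
    Exec (tset r e) s (1 + e.cost + 1) (s.write 2 r (e.eval s)) := Exec.set _ _ _ _

lemma exec_vset (r : ℕ) (e : Expr) (s : Memory) :
    Exec (vset r e) s (1 + e.cost + 1) (s.write 3 r (e.eval s)) := Exec.set _ _ _ _

/-- The Hoare rule for a loop of exactly `m` rounds: the invariant is indexed by the round, and it
decides the loop condition. -/
lemma exec_loop {body : Prog} {e : Expr} (Inv : ℕ → Memory → Prop) (m T : ℕ)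
    (hstep : ∀ i < m, ∀ s, Inv i s → e.eval s ≠ 0 ∧
      ∃ t s', Exec body s t s' ∧ t ≤ T ∧ Inv (i + 1) s')
    (hend : ∀ s, Inv m s → e.eval s = 0) (s : Memory) (h0 : Inv 0 s) :
    ∃ t s', Exec (Prog.loop e body) s t s' ∧ t ≤ m * (e.cost + 1 + T) + (e.cost + 1) ∧
      Inv m s' := by
  have key : ∀ k i, i + k = m → ∀ s, Inv i s →
      ∃ t s', Exec (Prog.loop e body) s t s' ∧ t ≤ k * (e.cost + 1 + T) + (e.cost + 1) ∧
        Inv m s' := by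
    intro k
    induction k with
    | zero =>
      intro i hi s hs
      obtain rfl : i = m := by omega
      exact ⟨_, _, Exec.loop_done _ (hend s hs), by simp, hs⟩
    | succ k ih =>
      intro i hi s hs
      obtain ⟨hne, t, s', hex, ht, hI⟩ := hstep i (by omega) s hs
      obtain ⟨t', s'', hex', ht', hI'⟩ := ih (i + 1) (by omega) s' hI
      refine ⟨_, _, Exec.loop_step hne hex hex', ?_, hI'⟩
      rw [Nat.succ_mul]; omega
  exact key m 0 (by omega) s h0

/-! ### Closure properties of polynomial-time expressions -/

lemma CompE.lit (m : ℕ) : CompE Γ (fun _ _ => m) := fun r =>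
  ⟨tset r (Expr.lit m), (3 : ℕ), fun _ _ s _ => ⟨_, _, exec_tset _ _ _, by
    rw [Polynomial.eval_natCast]; simp [Expr.cost], by simp [Expr.eval],
    Keep.write_tmp _ _ le_rfl⟩⟩

lemma CompE.var (i : ℕ) (hi : i < Γ.depth) : CompE Γ (fun e _ => Γ.var e i) := fun r =>
  ⟨tset r (vget i), (4 : ℕ), fun _ _ s hs => ⟨_, _, exec_tset _ _ _, by
    rw [Polynomial.eval_natCast]; simp [vget, Expr.cost], by simp [hs.var i hi],
    Keep.write_tmp _ _ le_rfl⟩⟩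

/-- Evaluation of two functions followed by a combination of their values. -/
lemma CompE.comb₂ {f g : E → State → ℕ} (hf : CompE Γ f) (hg : CompE Γ g) (op : ℕ → ℕ → ℕ)
    (opE : Expr → Expr → Expr) (c : ℕ) (hop : ∀ s a b, (opE a b).eval s = op (a.eval s) (b.eval s))
    (hc : ∀ r r', (opE (tget r) (tget r')).cost = c) : CompE Γ (fun e σ => op (f e σ) (g e σ)) := by
  intro r
  obtain ⟨p₁, q₁, h₁⟩ := hf r
  -- The value of `f` stays in cell `r` while `g` is evaluated above it.
  obtain ⟨p₂, q₂, h₂⟩ := hg (r + 1)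
  refine ⟨(p₁.seq p₂).seq (tset r (opE (tget r) (tget (r + 1)))), q₁ + q₂ + ((1 + c + 1 : ℕ)), ?_⟩
  intro e σ s hs
  obtain ⟨t₁, s₁, ex₁, ht₁, v₁, k₁⟩ := h₁ e σ s hs
  obtain ⟨t₂, s₂, ex₂, ht₂, v₂, k₂⟩ := h₂ e σ s₁ (hs.keep k₁)
  refine ⟨_, _, Exec.seq (Exec.seq ex₁ ex₂) (exec_tset _ _ _), ?_, ?_, ?_⟩
  · rw [hc, Polynomial.eval_add, Polynomial.eval_add, Polynomial.eval_natCast]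
    simp only [Nat.cast_id]; omega
  · simp [hop, v₂, k₂.tmp r (by omega), v₁]
  · exact (k₁.trans k₂ (by omega) le_rfl).tset le_rfl

lemma CompE.add {f g : E → State → ℕ} (hf : CompE Γ f) (hg : CompE Γ g) :
    CompE Γ (fun e σ => f e σ + g e σ) :=
  hf.comb₂ hg (· + ·) Expr.add 5 (fun _ _ _ => rfl) (fun _ _ => rfl)

lemma CompE.sub {f g : E → State → ℕ} (hf : CompE Γ f) (hg : CompE Γ g) :
    CompE Γ (fun e σ => f e σ - g e σ) :=
  hf.comb₂ hg (· - ·) Expr.sub 5 (fun _ _ _ => rfl) (fun _ _ => rfl)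

lemma CompE.input {f : E → State → ℕ} (hf : CompE Γ f) :
    CompE Γ (fun e σ => RAM.input (Γ.word e) 0 (f e σ)) := by
  intro r
  obtain ⟨p, q, h⟩ := hf r
  refine ⟨p.seq (tset r (Expr.get 0 (tget r))), q + (5 : ℕ), fun e σ s hs => ?_⟩
  obtain ⟨t, s', ex, ht, v, k⟩ := h e σ s hs
  refine ⟨_, _, Exec.seq ex (exec_tset _ _ _), ?_, ?_, ?_⟩
  · rw [Polynomial.eval_add, Polynomial.eval_natCast]; simp [Expr.cost, tget]; omega
  · simp [Expr.eval, v, (hs.keep k).inp]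
  · exact k.tset le_rfl

lemma CompE.length : CompE Γ (fun e _ => Γ.N e) := (CompE.lit 0).input

/-- The machine address of a cell whose indices are in temporary cells. -/
def addr (r : ℕ) : Expr :=
  ((Expr.get 5 (clamp (tget r))).add (Expr.get 4 (clamp (tget (r + 1))))).add
    (clamp (tget (r + 2)))

lemma eval_addr {e : E} {σ : State} {s : Memory} (hs : Rep Γ e σ s) (r : ℕ) :
    (addr r).eval s = min (s 2 r) (Γ.N e) * ((Γ.N e + 1) * (Γ.N e + 1)) +
      min (s 2 (r + 1)) (Γ.N e) * (Γ.N e + 1) + min (s 2 (r + 2)) (Γ.N e) := by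
  simp only [addr, Expr.eval, eval_clamp hs.length, eval_tget]
  rw [hs.tab₁ _ (min_le_right _ _), hs.tab₂ _ (min_le_right _ _)]

lemma CompE.three {f g h : E → State → ℕ} (hf : CompE Γ f) (hg : CompE Γ g) (hh : CompE Γ h)
    (r : ℕ) : ∃ (p : Prog) (q : Polynomial ℕ), ∀ e σ s, Rep Γ e σ s →
      ∃ t s', Exec p s t s' ∧ t ≤ q.eval (Γ.N e) ∧ s' 2 r = f e σ ∧ s' 2 (r + 1) = g e σ ∧
        s' 2 (r + 2) = h e σ ∧ Keep r Γ.depth s s' := by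
  obtain ⟨p₁, q₁, h₁⟩ := hf r
  obtain ⟨p₂, q₂, h₂⟩ := hg (r + 1)
  obtain ⟨p₃, q₃, h₃⟩ := hh (r + 2)
  refine ⟨(p₁.seq p₂).seq p₃, q₁ + q₂ + q₃, fun e σ s hs => ?_⟩
  obtain ⟨t₁, s₁, ex₁, ht₁, v₁, k₁⟩ := h₁ e σ s hs
  obtain ⟨t₂, s₂, ex₂, ht₂, v₂, k₂⟩ := h₂ e σ s₁ (hs.keep k₁)
  obtain ⟨t₃, s₃, ex₃, ht₃, v₃, k₃⟩ := h₃ e σ s₂ ((hs.keep k₁).keep k₂)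
  refine ⟨_, _, Exec.seq (Exec.seq ex₁ ex₂) ex₃, ?_, ?_, ?_, v₃, ?_⟩
  · rw [Polynomial.eval_add, Polynomial.eval_add]; omega
  · rw [k₃.tmp r (by omega), k₂.tmp r (by omega), v₁]
  · rw [k₃.tmp (r + 1) (by omega), v₂]
  · exact (k₁.trans k₂ (by omega) le_rfl).trans k₃ (by omega) le_rfl

lemma CompE.get {i j k : E → State → ℕ} (a : ℕ) (hi : CompE Γ i) (hj : CompE Γ j)
    (hk : CompE Γ k) :
    CompE Γ (fun e σ => State.rd (Γ.N e) σ a (i e σ) (j e σ) (k e σ)) := by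
  intro r
  obtain ⟨p, q, h⟩ := hi.three hj hk r
  refine ⟨p.seq (tset r (Expr.get (phys a) (addr r))), q + ((1 + ((addr r).cost + 1) + 1 : ℕ)),
    fun e σ s hs => ?_⟩
  obtain ⟨t, s', ex, ht, v₁, v₂, v₃, hk⟩ := h e σ s hs
  refine ⟨_, _, Exec.seq ex (exec_tset _ _ _), ?_, ?_, ?_⟩
  · rw [Polynomial.eval_add, Polynomial.eval_natCast]; simp only [Expr.cost, Nat.cast_id]; omega
  · simp only [write_self, Expr.eval, eval_addr (hs.keep hk)]
    rw [(hs.keep hk).arr _ _ _ _ (min_le_right _ _) (min_le_right _ _) (min_le_right _ _),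
      v₁, v₂, v₃]
    rfl
  · exact hk.tset le_rfl

lemma CompE.ite {c f g : E → State → ℕ} (hc : CompE Γ c) (hf : CompE Γ f) (hg : CompE Γ g) :
    CompE Γ (fun e σ => if c e σ ≠ 0 then f e σ else g e σ) := by
  intro r
  obtain ⟨p₁, q₁, h₁⟩ := hc r
  obtain ⟨p₂, q₂, h₂⟩ := hf r
  obtain ⟨p₃, q₃, h₃⟩ := hg r
  refine ⟨p₁.seq (Prog.ite (tget r) p₂ p₃), q₁ + q₂ + q₃ + (3 : ℕ), fun e σ s hs => ?_⟩
  obtain ⟨t₁, s₁, ex₁, ht₁, v₁, k₁⟩ := h₁ e σ s hs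
  have hcost : (tget r).cost = 2 := rfl
  by_cases hz : c e σ ≠ 0
  · obtain ⟨t₂, s₂, ex₂, ht₂, v₂, k₂⟩ := h₂ e σ s₁ (hs.keep k₁)
    refine ⟨_, _, Exec.seq ex₁ (Exec.ite_true _ (by simpa [v₁] using hz) ex₂), ?_, ?_,
      k₁.trans k₂ le_rfl le_rfl⟩
    · simp only [Polynomial.eval_add, Polynomial.eval_natCast, Nat.cast_id]; omega
    · simp [hz, v₂]
  · obtain ⟨t₂, s₂, ex₂, ht₂, v₂, k₂⟩ := h₃ e σ s₁ (hs.keep k₁)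
    refine ⟨_, _, Exec.seq ex₁ (Exec.ite_false _ (by simpa [v₁] using hz) ex₂), ?_, ?_,
      k₁.trans k₂ le_rfl le_rfl⟩
    · simp only [Polynomial.eval_add, Polynomial.eval_natCast, Nat.cast_id]; omega
    · simp [hz, v₂]

/-- Accumulation of the values of `f` over the rounds of a loop. -/
lemma CompE.accumulate {b : E → State → ℕ} {f : E × ℕ → State → ℕ} (hb : CompE Γ b)
    (hf : CompE Γ.ext f) (op : ℕ → ℕ → ℕ) (opE : Expr → Expr → Expr) (c : ℕ)
    (hop : ∀ s a b, (opE a b).eval s = op (a.eval s) (b.eval s))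
    (hc : ∀ r r', (opE (tget r) (tget r')).cost = c) :
    CompE Γ (fun e σ =>
      (Nat.rec 0 (fun i acc => op acc (f (e, i) σ)) (min (b e σ) (Γ.N e)) : ℕ)) := by
  intro r
  obtain ⟨p₁, q₁, h₁⟩ := hb r
  obtain ⟨p₂, q₂, h₂⟩ := hf (r + 2)
  set body : Prog := (p₂.seq (tset (r + 1) (opE (tget (r + 1)) (tget (r + 2))))).seq
    (vset Γ.depth ((vget Γ.depth).add (Expr.lit 1))) with hbody
  set cond : Expr := (tget r).sub (vget Γ.depth) with hcond
  refine ⟨((((p₁.seq (tset r (clamp (tget r)))).seq (tset (r + 1) (Expr.lit 0))).seq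
    (vset Γ.depth (Expr.lit 0))).seq (Prog.loop cond body)).seq (tset r (tget (r + 1))),
    q₁ + Polynomial.X * (q₂ + ((c + 15 : ℕ) : Polynomial ℕ)) + ((50 : ℕ) : Polynomial ℕ),
    fun e σ s hs => ?_⟩
  obtain ⟨t₁, s₁, ex₁, ht₁, v₁, k₁⟩ := h₁ e σ s hs
  set m := min (b e σ) (Γ.N e) with hm
  have hr₁ := hs.keep k₁
  set s₂ := s₁.write 2 r ((clamp (tget r)).eval s₁) with hs₂
  set s₃ := s₂.write 2 (r + 1) ((Expr.lit 0).eval s₂) with hs₃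
  set s₄ := s₃.write 3 Γ.depth ((Expr.lit 0).eval s₃) with hs₄
  have k₄ : Keep r Γ.depth s s₄ := ((k₁.tset le_rfl).tset (by omega)).vset le_rfl
  have hm₄ : s₄ 2 r = m := by
    rw [hs₄, write_of_ne (by simp), hs₃, write_of_ne (by simp), hs₂, write_self,
      eval_clamp hr₁.length, eval_tget, v₁]
  let acc : ℕ → ℕ := fun k => Nat.rec 0 (fun i acc => op acc (f (e, i) σ)) k
  -- Cell `r` holds the number of rounds, cell `r + 1` the accumulator, cell `r + 2` the new term,
  -- and loop variable `Γ.depth` the counter.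
  obtain ⟨t₅, s₅, ex₅, ht₅, k₅, -, hacc, -⟩ := exec_loop (body := body) (e := cond)
    (fun i s' => Keep r Γ.depth s s' ∧ s' 2 r = m ∧ s' 2 (r + 1) = acc i ∧ s' 3 Γ.depth = i)
    m (q₂.eval (Γ.N e) + (c + 8)) (by
      rintro i hi s' ⟨hk, h1, h2, h3⟩
      refine ⟨?_, ?_⟩
      · simp only [hcond, Expr.eval, eval_tget, eval_vget, h1, h3]; omega
      · obtain ⟨t, s'', ex, ht, v, k⟩ := h₂ (e, i) σ s' ((hs.keep hk).ext h3)
        refine ⟨_, _, Exec.seq (Exec.seq ex (exec_tset _ _ _)) (exec_vset _ _ _),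
          ?_, ?_, ?_, ?_, ?_⟩
        · rw [hc]; simp only [Expr.cost, vget]
          change t ≤ q₂.eval (Γ.N e) at ht
          omega
        · exact ((hk.trans k (by omega) (Nat.le_succ _)).tset (by omega)).vset le_rfl
        · rw [write_of_ne (by simp), write_of_ne (by simp), k.tmp r (by omega), h1]
        · rw [write_of_ne (by simp), write_self, hop, eval_tget, eval_tget, v,
            k.tmp (r + 1) (by omega), h2]
        · rw [write_self]
          simp only [Expr.eval, eval_vget]
          rw [write_of_ne (by simp), k.var Γ.depth (by simp [Ctx.ext]), h3])
    (by
      rintro s' ⟨_, h1, _, h3⟩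
      simp only [hcond, Expr.eval, eval_tget, eval_vget, h1, h3]; omega)
    s₄ ⟨k₄, hm₄, by
      rw [hs₄, write_of_ne (by simp), hs₃, write_self]; rfl, by rw [hs₄, write_self]; rfl⟩
  refine ⟨_, _, Exec.seq (Exec.seq (Exec.seq (Exec.seq (Exec.seq ex₁ (exec_tset _ _ _))
    (exec_tset _ _ _)) (exec_vset _ _ _)) ex₅) (exec_tset _ _ _), ?_, ?_, ?_⟩
  · have hmN : m ≤ Γ.N e := min_le_right _ _
    have hcc : cond.cost = 5 := rfl
    have : t₅ ≤ Γ.N e * (q₂.eval (Γ.N e) + (c + 15)) + 6 := by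
      rw [hcc] at ht₅
      exact ht₅.trans (Nat.add_le_add (Nat.mul_le_mul hmN (by omega)) le_rfl)
    simp only [Polynomial.eval_add, Polynomial.eval_mul, Polynomial.eval_X, Polynomial.eval_natCast,
      Nat.cast_id, Expr.cost, clamp, tget]
    omega
  · rw [write_self, eval_tget, hacc]
  · exact k₅.tset le_rfl

lemma CompE.sum {b N : E → State → ℕ} {f : E → State → ℕ → ℕ} (hb : CompE Γ b)
    (hf : CompE Γ.ext (fun p σ => f p.1 σ p.2)) (hN : ∀ e σ, N e σ = Γ.N e) :
    CompE Γ (fun e σ => sumTo (N e σ) (b e σ) (f e σ)) := by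
  have := hb.accumulate hf (· + ·) Expr.add 5 (fun _ _ _ => rfl) (fun _ _ => rfl)
  convert this using 3 with e σ
  rw [hN, sumTo]
  induction min (b e σ) (Γ.N e) with
  | zero => rfl
  | succ k ih => rw [Finset.sum_range_succ, ih]

lemma CompE.sup {b N : E → State → ℕ} {f : E → State → ℕ → ℕ} (hb : CompE Γ b)
    (hf : CompE Γ.ext (fun p σ => f p.1 σ p.2)) (hN : ∀ e σ, N e σ = Γ.N e) :
    CompE Γ (fun e σ => supTo (N e σ) (b e σ) (f e σ)) := by
  -- With truncated subtraction, `a + (b - a)` is the maximum.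
  have := hb.accumulate hf (fun a b => a + (b - a)) (fun a b => a.add (b.sub a)) 8
    (fun _ _ _ => rfl) (fun _ _ => rfl)
  convert this using 3 with e σ
  rw [hN, supTo]
  induction min (b e σ) (Γ.N e) with
  | zero => rfl
  | succ k ih =>
    rw [Finset.range_add_one, Finset.sup_insert, ih]
    exact (by intro a b; omega : ∀ a b : ℕ, max a b = b + (a - b)) _ _

lemma CompE.rd {N i j k : E → State → ℕ} (a : ℕ) (hi : CompE Γ i) (hj : CompE Γ j)
    (hk : CompE Γ k) (hN : ∀ e σ, N e σ = Γ.N e) :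
    CompE Γ (fun e σ => State.rd (N e σ) σ a (i e σ) (j e σ) (k e σ)) := by
  simpa only [hN] using CompE.get a hi hj hk

lemma CompE.ite_eq {a b f g : E → State → ℕ} (ha : CompE Γ a) (hb : CompE Γ b) (hf : CompE Γ f)
    (hg : CompE Γ g) : CompE Γ (fun e σ => if a e σ = b e σ then f e σ else g e σ) := by
  convert ((ha.sub hb).add (hb.sub ha)).ite hg hf using 3 with e σ
  by_cases h : a e σ = b e σ
  · simp [h]
  · rw [if_neg h, if_pos (by omega)]

lemma CompE.ite_lt {a b f g : E → State → ℕ} (ha : CompE Γ a) (hb : CompE Γ b) (hf : CompE Γ f)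
    (hg : CompE Γ g) : CompE Γ (fun e σ => if a e σ < b e σ then f e σ else g e σ) := by
  convert (hb.sub ha).ite hf hg using 3 with e σ
  by_cases h : a e σ < b e σ
  · rw [if_pos h, if_pos (by omega)]
  · rw [if_neg h, if_neg (by omega)]

/-! Statements -/

lemma CompS.seq {F G : E → State → State} (hF : CompS Γ F) (hG : CompS Γ G) :
    CompS Γ (fun e σ => G e (F e σ)) := by
  intro r
  obtain ⟨p₁, q₁, h₁⟩ := hF r
  obtain ⟨p₂, q₂, h₂⟩ := hG r
  refine ⟨p₁.seq p₂, q₁ + q₂, fun e σ s hs => ?_⟩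
  obtain ⟨t₁, s₁, ex₁, ht₁, v₁, k₁⟩ := h₁ e σ s hs
  obtain ⟨t₂, s₂, ex₂, ht₂, v₂, k₂⟩ := h₂ e _ s₁ v₁
  exact ⟨_, _, Exec.seq ex₁ ex₂, by rw [Polynomial.eval_add]; omega, v₂,
    fun i hi => (k₂ i hi).trans (k₁ i hi)⟩

lemma CompS.ite_lt {a b : E → State → ℕ} {F G : E → State → State} (ha : CompE Γ a)
    (hb : CompE Γ b) (hF : CompS Γ F) (hG : CompS Γ G) :
    CompS Γ (fun e σ => if a e σ < b e σ then F e σ else G e σ) := by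
  intro r
  obtain ⟨p₁, q₁, h₁⟩ := (hb.sub ha) r
  obtain ⟨p₂, q₂, h₂⟩ := hF r
  obtain ⟨p₃, q₃, h₃⟩ := hG r
  refine ⟨p₁.seq (Prog.ite (tget r) p₂ p₃), q₁ + q₂ + q₃ + (3 : ℕ), fun e σ s hs => ?_⟩
  obtain ⟨t₁, s₁, ex₁, ht₁, v₁, k₁⟩ := h₁ e σ s hs
  have hcost : (tget r).cost = 2 := rfl
  by_cases hz : a e σ < b e σ
  · obtain ⟨t₂, s₂, ex₂, ht₂, v₂, k₂⟩ := h₂ e σ s₁ (hs.keep k₁)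
    refine ⟨_, _, Exec.seq ex₁ (Exec.ite_true _ (by rw [eval_tget, v₁]; simp only; omega) ex₂),
      ?_, ?_,
      fun i hi => (k₂ i hi).trans (k₁.tmp i hi)⟩
    · simp only [Polynomial.eval_add, Polynomial.eval_natCast, Nat.cast_id]; omega
    · simpa [hz] using v₂
  · obtain ⟨t₂, s₂, ex₂, ht₂, v₂, k₂⟩ := h₃ e σ s₁ (hs.keep k₁)
    refine ⟨_, _, Exec.seq ex₁ (Exec.ite_false _ (by rw [eval_tget, v₁]; simp only; omega) ex₂),
      ?_, ?_,
      fun i hi => (k₂ i hi).trans (k₁.tmp i hi)⟩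
    · simp only [Polynomial.eval_add, Polynomial.eval_natCast, Nat.cast_id]; omega
    · simpa [hz] using v₂

lemma CompS.skip : CompS Γ (fun _ σ => σ) := fun _ =>
  ⟨Prog.skip, (1 : ℕ), fun _ _ s hs => ⟨_, _, Exec.skip s, by rw [Polynomial.eval_natCast]; simp,
    hs, fun _ _ => rfl⟩⟩

/-- Uniqueness of digits in base `D`; it guarantees that a write does not affect the cells of other
index triples. -/
lemma addr_inj {D i j k i' j' k' : ℕ} (hj : j < D) (hk : k < D) (hj' : j' < D) (hk' : k' < D)
    (h : i * (D * D) + j * D + k = i' * (D * D) + j' * D + k') : i = i' ∧ j = j' ∧ k = k' := by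
  have hD : 0 < D := by omega
  have e1 : (i * D + j) * D + k = (i' * D + j') * D + k' := by linarith [h]
  have hkk : k = k' := by
    have := congrArg (· % D) e1
    simpa [Nat.add_mod, Nat.mod_eq_of_lt hk, Nat.mod_eq_of_lt hk'] using this
  subst hkk
  have e2 : i * D + j = i' * D + j' := Nat.eq_of_mul_eq_mul_right hD (by omega)
  have hjj : j = j' := by
    have := congrArg (· % D) e2
    simpa [Nat.add_mod, Nat.mod_eq_of_lt hj, Nat.mod_eq_of_lt hj'] using this
  subst hjj
  exact ⟨Nat.eq_of_mul_eq_mul_right hD (by omega), rfl, rfl⟩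

lemma CompS.set {N i j k x : E → State → ℕ} (a : ℕ) (hi : CompE Γ i) (hj : CompE Γ j)
    (hk : CompE Γ k) (hx : CompE Γ x) (hN : ∀ e σ, N e σ = Γ.N e) :
    CompS Γ (fun e σ => State.wr (N e σ) σ a (i e σ) (j e σ) (k e σ) (x e σ)) := by
  intro r
  obtain ⟨p, q, h⟩ := hi.three hj hk r
  obtain ⟨p', q', h'⟩ := hx (r + 3)
  refine ⟨(p.seq p').seq (Prog.set (phys a) (addr r) (tget (r + 3))),
    q + q' + (((addr r).cost + 2 + 1 : ℕ)), fun e σ s hs => ?_⟩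
  obtain ⟨t, s', ex, ht, v₁, v₂, v₃, hk⟩ := h e σ s hs
  obtain ⟨t', s'', ex', ht', v', hk'⟩ := h' e σ s' (hs.keep hk)
  have hs'' := (hs.keep hk).keep hk'
  obtain ⟨n0, n2, n3, n4, n5⟩ := phys_spec a
  refine ⟨_, _, Exec.seq (Exec.seq ex ex') (Exec.set _ _ _ _), ?_, ?_, ?_⟩
  · rw [Polynomial.eval_add, Polynomial.eval_add, Polynomial.eval_natCast]
    simp only [Expr.cost, Nat.cast_id, tget]; omega
  · have other : ∀ a', a' ≠ phys a → ∀ z y, s''.write (phys a) z y a' = s'' a' := by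
      intro a' ha' z y
      simp [Memory.write, ha']
    rw [eval_addr hs'', eval_tget, v', hk'.tmp r (by omega), hk'.tmp (r + 1) (by omega),
      hk'.tmp (r + 2) (by omega), v₁, v₂, v₃]
    simp only [hN]
    refine ⟨by rw [other _ n0.symm, hs''.inp], ?_, ?_, ?_, ?_⟩
    · rw [other _ n4.symm]; exact hs''.tab₁
    · rw [other _ n5.symm]; exact hs''.tab₂
    · intro a' i' j' k' hi' hj' hk'
      by_cases ha : a' = a
      · subst ha
        by_cases hc : i' = min (i e σ) (Γ.N e) ∧ j' = min (j e σ) (Γ.N e) ∧ k' = min (k e σ) (Γ.N e)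
        · obtain ⟨rfl, rfl, rfl⟩ := hc
          simp [State.wr]
        · rw [write_of_ne, hs''.arr _ _ _ _ hi' hj' hk']
          · simp [State.wr, hc]
          · right
            intro heq
            exact hc (addr_inj (by omega) (by omega) (by omega) (by omega) heq)
      · rw [write_of_ne (Or.inl fun h => ha (phys_injective h)), hs''.arr _ _ _ _ hi' hj' hk']
        simp [State.wr, ha]
    · rw [other _ n3.symm]; exact hs''.var
  · intro i hi
    rw [write_of_ne (Or.inl n2.symm), hk'.tmp i (by omega), hk.tmp i hi]

lemma CompS.for {b N : E → State → ℕ} {F : E → ℕ → State → State} (hb : CompE Γ b)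
    (hF : CompS Γ.ext (fun p σ => F p.1 p.2 σ)) (hN : ∀ e σ, N e σ = Γ.N e) :
    CompS Γ (fun e σ => forTo (N e σ) (b e σ) (F e) σ) := by
  intro r
  obtain ⟨p₁, q₁, h₁⟩ := hb r
  obtain ⟨p₂, q₂, h₂⟩ := hF (r + 1)
  set body : Prog := p₂.seq (vset Γ.depth ((vget Γ.depth).add (Expr.lit 1))) with hbody
  set cond : Expr := (tget r).sub (vget Γ.depth) with hcond
  refine ⟨((p₁.seq (tset r (clamp (tget r)))).seq (vset Γ.depth (Expr.lit 0))).seq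
    (Prog.loop cond body),
    q₁ + Polynomial.X * (q₂ + ((12 : ℕ) : Polynomial ℕ)) + ((50 : ℕ) : Polynomial ℕ),
    fun e σ s hs => ?_⟩
  obtain ⟨t₁, s₁, ex₁, ht₁, v₁, k₁⟩ := h₁ e σ s hs
  set m := min (b e σ) (Γ.N e) with hm
  have hr₁ := hs.keep k₁
  set s₂ := s₁.write 2 r ((clamp (tget r)).eval s₁) with hs₂
  set s₃ := s₂.write 3 Γ.depth ((Expr.lit 0).eval s₂) with hs₃
  have k₃ : Keep r Γ.depth s s₃ := (k₁.tset le_rfl).vset le_rfl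
  have hm₃ : s₃ 2 r = m := by
    rw [hs₃, write_of_ne (by simp), hs₂, write_self, eval_clamp hr₁.length, eval_tget, v₁]
  obtain ⟨t₅, s₅, ex₅, ht₅, hrep, -, -, htmp⟩ := exec_loop (body := body) (e := cond)
    (fun i s' => Rep Γ e (rounds (F e) i σ) s' ∧ s' 2 r = m ∧ s' 3 Γ.depth = i ∧
      ∀ j < r, s' 2 j = s 2 j)
    m (q₂.eval (Γ.N e) + 6) (by
      rintro i hi s' ⟨hk, h1, h2, h3⟩
      refine ⟨?_, ?_⟩
      · simp only [hcond, Expr.eval, eval_tget, eval_vget, h1, h2]; omega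
      · obtain ⟨t, s'', ex, ht, v, k⟩ := h₂ (e, i) _ s' (hk.ext h2)
        refine ⟨_, _, Exec.seq ex (exec_vset _ _ _), ?_, ?_, ?_, ?_, ?_⟩
        · simp only [Expr.cost, vget]
          change t ≤ q₂.eval (Γ.N e) at ht
          omega
        -- The counter lies outside the variables of `Γ`, so incrementing it preserves the
        -- representation; the body itself has preserved the counter, as a variable of `Γ.ext`.
        · exact v.of_ext.1.keep ((Keep.refl 0 _ _).vset le_rfl)
        · rw [write_of_ne (by simp), k r (by omega), h1]
        · rw [write_self]
          simp only [Expr.eval, eval_vget]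
          rw [v.of_ext.2]
        · intro j hj
          rw [write_of_ne (by simp), k j (by omega), h3 j hj])
    (by
      rintro s' ⟨_, h1, h3, _⟩
      simp only [hcond, Expr.eval, eval_tget, eval_vget, h1, h3]; omega)
    s₃ ⟨hs.keep k₃, hm₃, by rw [hs₃, write_self]; rfl, k₃.tmp⟩
  refine ⟨_, _, Exec.seq (Exec.seq (Exec.seq ex₁ (exec_tset _ _ _)) (exec_vset _ _ _)) ex₅,
    ?_, ?_, htmp⟩
  · have hmN : m ≤ Γ.N e := min_le_right _ _
    have hcc : cond.cost = 5 := rfl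
    have : t₅ ≤ Γ.N e * (q₂.eval (Γ.N e) + 12) + 6 := by
      rw [hcc] at ht₅
      exact ht₅.trans (Nat.add_le_add (Nat.mul_le_mul hmN (by omega)) le_rfl)
    simp only [Polynomial.eval_add, Polynomial.eval_mul, Polynomial.eval_X, Polynomial.eval_natCast,
      Nat.cast_id, Expr.cost, clamp, tget]
    omega
  · simp only [hN, forTo]; exact hrep

/-! Whole programs -/

/-- The context without loop variables, where the environment is the input word. -/
def Ctx.base : Ctx (List Bool) := ⟨0, id, fun _ _ => 0⟩

/-- The tables for address computations can be set up in polynomial time. -/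
lemma exec_tables : ∃ (p : Prog) (q : Polynomial ℕ), ∀ x : List Bool, ∃ t s,
    Exec p (RAM.input x) t s ∧ t ≤ q.eval x.length ∧ Rep Ctx.base x (fun _ _ _ _ => 0) s := by
  set len : Expr := Expr.get 0 (Expr.lit 0)
  set v : Expr := vget 0
  set inc : Prog := vset 0 (v.add (Expr.lit 1))
  set cond : Expr := len.sub v
  set e₁ : Expr := ((Expr.get 4 v).add len).add (Expr.lit 1)
  -- The increment is `(N + 1) * (N + 1) = N * (N + 1) + N + 1`, whose first summand is the last
  -- entry of the first table.
  set e₂ : Expr := (((Expr.get 5 v).add (Expr.get 4 len)).add len).add (Expr.lit 1)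
  set b₁ : Prog := (Prog.set 4 (v.add (Expr.lit 1)) e₁).seq inc
  set b₂ : Prog := (Prog.set 5 (v.add (Expr.lit 1)) e₂).seq inc
  refine ⟨((Prog.loop cond b₁).seq (vset 0 (Expr.lit 0))).seq (Prog.loop cond b₂),
    Polynomial.X * ((100 : ℕ) : Polynomial ℕ) + ((50 : ℕ) : Polynomial ℕ), fun x => ?_⟩
  set N := x.length with hN
  obtain ⟨t₁, s₁, ex₁, ht₁, o₁, T₁, -⟩ := exec_loop (body := b₁) (e := cond)
    (fun m s => (∀ a, a ≠ 3 → a ≠ 4 → s a = RAM.input x a) ∧ (∀ i ≤ m, s 4 i = i * (N + 1)) ∧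
      s 3 0 = m) N 30 (by
      rintro i hi s ⟨h1, h2, h3⟩
      have hl : s 0 0 = N := by rw [h1 0 (by simp) (by simp)]; rfl
      refine ⟨by simp [cond, Expr.eval, len, v, hl, h3]; omega, _, _,
        Exec.seq (Exec.set _ _ _ _) (exec_vset _ _ _), by decide, ?_, ?_, ?_⟩
      · intro a ha3 ha4
        funext j
        rw [write_of_ne (Or.inl ha3), write_of_ne (Or.inl ha4), h1 a ha3 ha4]
      · intro j hj
        rw [write_of_ne (by simp)]
        simp only [Expr.eval, v, eval_vget, h3, e₁, len, hl]
        by_cases hji : j = i + 1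
        · subst hji
          rw [write_self, h2 i le_rfl]; ring
        · rw [write_of_ne (Or.inr hji), h2 j (by omega)]
      · rw [write_self]; simp only [Expr.eval, v, eval_vget]; rw [write_of_ne (by simp), h3])
    (by
      rintro s ⟨h1, -, h3⟩
      have hl : s 0 0 = N := by rw [h1 0 (by simp) (by simp)]; rfl
      simp [cond, Expr.eval, len, v, hl, h3])
    (RAM.input x) ⟨fun _ _ _ => rfl, fun i hi => by
      obtain rfl : i = 0 := by omega
      simp [RAM.input], rfl⟩
  obtain ⟨t₂, s₂, ex₂, ht₂, o₂, T₂, T₃, -⟩ := exec_loop (body := b₂) (e := cond)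
    (fun m s => (∀ a, a ≠ 3 → a ≠ 4 → a ≠ 5 → s a = RAM.input x a) ∧
      (∀ i ≤ N, s 4 i = i * (N + 1)) ∧ (∀ i ≤ m, s 5 i = i * ((N + 1) * (N + 1))) ∧
      s 3 0 = m) N 30 (by
      rintro i hi s ⟨h1, h2, h2', h3⟩
      have hl : s 0 0 = N := by rw [h1 0 (by simp) (by simp) (by simp)]; rfl
      refine ⟨by simp [cond, Expr.eval, len, v, hl, h3]; omega, _, _,
        Exec.seq (Exec.set _ _ _ _) (exec_vset _ _ _), by decide, ?_, ?_, ?_, ?_⟩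
      · intro a ha3 ha4 ha5
        funext j
        rw [write_of_ne (Or.inl ha3), write_of_ne (Or.inl ha5), h1 a ha3 ha4 ha5]
      · intro j hj
        rw [write_of_ne (by simp), write_of_ne (by simp), h2 j hj]
      · intro j hj
        rw [write_of_ne (by simp)]
        simp only [Expr.eval, v, eval_vget, h3, e₂, len, hl]
        by_cases hji : j = i + 1
        · subst hji
          rw [write_self, h2' i le_rfl, h2 N le_rfl]; ring
        · rw [write_of_ne (Or.inr hji), h2' j (by omega)]
      · rw [write_self]; simp only [Expr.eval, v, eval_vget]; rw [write_of_ne (by simp), h3])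
    (by
      rintro s ⟨h1, -, -, h3⟩
      have hl : s 0 0 = N := by rw [h1 0 (by simp) (by simp) (by simp)]; rfl
      simp [cond, Expr.eval, len, v, hl, h3])
    (s₁.write 3 0 ((Expr.lit 0).eval s₁)) ⟨fun a ha3 ha4 _ => by
        funext j
        rw [write_of_ne (Or.inl ha3), o₁ a ha3 ha4], fun i hi => by
        rw [write_of_ne (by simp), T₁ i hi], fun i hi => by
        obtain rfl : i = 0 := by omega
        rw [write_of_ne (by simp), o₁ 5 (by simp) (by simp)]; simp [RAM.input],
        by rw [write_self]; rfl⟩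
  refine ⟨_, _, Exec.seq (Exec.seq ex₁ (exec_vset _ _ _)) ex₂, ?_, ?_⟩
  · have hc : cond.cost = 5 := rfl
    simp only [Polynomial.eval_add, Polynomial.eval_mul, Polynomial.eval_X,
      Polynomial.eval_natCast, Nat.cast_id, Expr.cost]
    rw [hc] at ht₁ ht₂
    omega
  · refine ⟨o₂ 0 (by simp) (by simp) (by simp), T₂, T₃, ?_,
      fun i hi => absurd hi (by simp [Ctx.base])⟩
    intro a i j k _ _ _
    obtain ⟨n0, n2, n3, n4, n5⟩ := phys_spec a
    rw [o₂ _ n3 n4 n5]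
    obtain ⟨b, hb⟩ := Nat.exists_eq_succ_of_ne_zero n0
    rw [hb]; rfl

/-- A computation on the three-dimensional arrays gives a machine program with polynomial running
time. The output is in array `0`. -/
lemma CompS.exists_prog {F : List Bool → State → State} (hF : CompS Ctx.base F) :
    ∃ (P : Prog) (q : Polynomial ℕ), ∀ (x : List Bool) (n : ℕ) (ψ : Fin n → ℕ), n ≤ x.length →
      F x (fun _ _ _ _ => 0) 0 0 0 0 = n →
      (∀ v : Fin n, F x (fun _ _ _ _ => 0) 0 0 0 (v + 1) = ψ v) →
      OutputsWithin P x (q.eval x.length) (List.ofFn ψ) := by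
  obtain ⟨p₁, q₁, h₁⟩ := exec_tables
  obtain ⟨p₂, q₂, h₂⟩ := hF 0
  refine ⟨p₁.seq p₂, q₁ + q₂, fun x n ψ hn h0 hψ => ?_⟩
  obtain ⟨t₁, s₁, ex₁, ht₁, hr₁⟩ := h₁ x
  obtain ⟨t₂, s₂, ex₂, ht₂, hr₂, -⟩ := h₂ x _ s₁ hr₁
  refine ⟨_, s₂, Exec.seq ex₁ ex₂, ?_, ?_⟩
  · rw [Polynomial.eval_add]
    exact Nat.add_le_add ht₁ ht₂
  · have e0 := hr₂.arr 0 0 0 0 (Nat.zero_le _) (Nat.zero_le _) (Nat.zero_le _)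
    simp only [phys, zero_mul, zero_add] at e0
    rw [h0] at e0
    have e1 : ∀ v : Fin n, s₂ 1 (v + 1) = ψ v := by
      intro v
      have := hr₂.arr 0 0 0 (v + 1) (Nat.zero_le _) (Nat.zero_le _)
        (by have : (v : ℕ) + 1 ≤ x.length := by omega
            exact this)
      simp only [phys, zero_mul, zero_add] at this
      rw [this, hψ]
    rw [output]
    apply List.ext_getElem
    · simp [e0]
    · intro i hi hi'
      simp only [List.getElem_ofFn]
      simp only [List.length_ofFn] at hi'
      exact e1 ⟨i, hi'⟩

end RAM

/-! ### Maximization over pseudoforests -/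

/-- Searching by means of a maximum. The default `0` does no harm: if the maximum is attained at a
`y` that fails `P`, it is `0`, and then the given witness must be `0` too. -/
lemma Finset.sup_select {m : ℕ} (P : ℕ → Prop) [DecidablePred P] (h : ∃ y < m, P y) :
    P ((Finset.range m).sup fun y => if P y then y else 0) ∧
      ((Finset.range m).sup fun y => if P y then y else 0) < m := by
  obtain ⟨y₀, hy₀, hP₀⟩ := h
  have hne : (Finset.range m).Nonempty := ⟨y₀, Finset.mem_range.2 hy₀⟩
  obtain ⟨y, hy, hs⟩ := Finset.exists_mem_eq_sup _ hne fun y => if P y then y else 0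
  have hle : y₀ ≤ (Finset.range m).sup fun y => if P y then y else 0 := by
    have := Finset.le_sup (f := fun y => if P y then y else 0) (Finset.mem_range.2 hy₀)
    simpa [hP₀] using this
  rw [hs] at hle ⊢
  by_cases hP : P y
  · simp only [hP, if_true]
    exact ⟨trivial, Finset.mem_range.1 hy⟩
  · simp only [hP, if_false] at hle ⊢
    obtain rfl : y₀ = 0 := by omega
    exact ⟨hP₀, by omega⟩

lemma Finset.exists_eq_sup_range {m : ℕ} (hm : 0 < m) (g : ℕ → ℕ) :
    ∃ y < m, g y = (Finset.range m).sup g := by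
  obtain ⟨y, hy, hs⟩ := Finset.exists_mem_eq_sup _ ⟨0, Finset.mem_range.2 hm⟩ g
  exact ⟨y, Finset.mem_range.1 hy, hs.symm⟩

/-- The total weight of the assignment `φ` on the arcs from `v` to `f v`. -/
def arcWeight (n : ℕ) (f : ℕ → ℕ) (w : ℕ → ℕ → ℕ → ℕ) (φ : ℕ → ℕ) : ℕ :=
  ∑ v ∈ Finset.range n, w v (φ v) (φ (f v))

section Pseudoforest

variable {n : ℕ} {f ρ K : ℕ → ℕ} {w m B : ℕ → ℕ → ℕ → ℕ}

/-- Both sides count the entries of the table along an assignment. -/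
lemma sum_table (hf : ∀ v < n, f v < n) (hρ : ∀ v < n, ρ v < n) (hρf : ∀ v < n, ρ (f v) = ρ v)
    (hB : ∀ v < n, ∀ y < K (ρ v), ∀ z < K v,
      B v y z = ∑ u ∈ Finset.range n, if f u = v then m u y z else 0)
    (φ : ℕ → ℕ) (hφ : ∀ v < n, φ v < K v) :
    ∑ v ∈ Finset.range n, B v (φ (ρ v)) (φ v) =
      ∑ u ∈ Finset.range n, m u (φ (ρ u)) (φ (f u)) := by
  have h1 : ∑ v ∈ Finset.range n, B v (φ (ρ v)) (φ v) = ∑ v ∈ Finset.range n,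
      ∑ u ∈ Finset.range n, if f u = v then m u (φ (ρ v)) (φ v) else 0 := by
    refine Finset.sum_congr rfl fun v hv => ?_
    have hv := Finset.mem_range.1 hv
    exact hB v hv _ (hφ _ (hρ v hv)) _ (hφ v hv)
  rw [h1, Finset.sum_comm]
  refine Finset.sum_congr rfl fun u hu => ?_
  have hu := Finset.mem_range.1 hu
  rw [Finset.sum_ite_eq, if_pos (Finset.mem_range.2 (hf u hu)), hρf u hu]

/-- The table entries of the roots, and the weights of the arcs. -/
lemma sum_table_roots (hf : ∀ v < n, f v < n) (hρ : ∀ v < n, ρ v < n)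
    (hρf : ∀ v < n, ρ (f v) = ρ v)
    (hB : ∀ v < n, ∀ y < K (ρ v), ∀ z < K v,
      B v y z = ∑ u ∈ Finset.range n, if f u = v then m u y z else 0)
    (φ : ℕ → ℕ) (hφ : ∀ v < n, φ v < K v)
    (hroot : ∀ u < n, ρ u = u → m u (φ u) (φ (f u)) = w u (φ u) (φ (f u))) :
    (∑ v ∈ Finset.range n with ρ v = v, B v (φ v) (φ v)) +
      (∑ v ∈ Finset.range n with ¬ ρ v = v, (B v (φ (ρ v)) (φ v) + w v (φ v) (φ (f v)))) =
    arcWeight n f w φ + ∑ v ∈ Finset.range n with ¬ ρ v = v, m v (φ (ρ v)) (φ (f v)) := by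
  have key := sum_table hf hρ hρf hB φ hφ
  rw [← Finset.sum_filter_add_sum_filter_not (Finset.range n) (fun v => ρ v = v)
      (fun v => B v (φ (ρ v)) (φ v)),
    ← Finset.sum_filter_add_sum_filter_not (Finset.range n) (fun v => ρ v = v)
      (fun u => m u (φ (ρ u)) (φ (f u)))] at key
  rw [arcWeight, ← Finset.sum_filter_add_sum_filter_not (Finset.range n) (fun v => ρ v = v)
    (fun v => w v (φ v) (φ (f v))), Finset.sum_add_distrib]
  have a1 : ∑ v ∈ Finset.range n with ρ v = v, B v (φ (ρ v)) (φ v) =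
      ∑ v ∈ Finset.range n with ρ v = v, B v (φ v) (φ v) :=
    Finset.sum_congr rfl fun v hv => by rw [(Finset.mem_filter.1 hv).2]
  have a2 : ∑ v ∈ Finset.range n with ρ v = v, m v (φ (ρ v)) (φ (f v)) =
      ∑ v ∈ Finset.range n with ρ v = v, w v (φ v) (φ (f v)) :=
    Finset.sum_congr rfl fun v hv => by
      obtain ⟨h1, h2⟩ := Finset.mem_filter.1 hv
      rw [h2, hroot v (Finset.mem_range.1 h1) h2]
  omega

/-- An assignment that is traced back in the table of the dynamic program is optimal. -/
theorem arcWeight_le_of_table (hf : ∀ v < n, f v < n) (hρ : ∀ v < n, ρ v < n)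
    (hρf : ∀ v < n, ρ (f v) = ρ v)
    (hB : ∀ v < n, ∀ y < K (ρ v), ∀ z < K v,
      B v y z = ∑ u ∈ Finset.range n, if f u = v then
        (if ρ u = u then w u y z else (Finset.range (K u)).sup fun a => B u y a + w u a z) else 0)
    (ψ : ℕ → ℕ) (hψ : ∀ v < n, ψ v < K v)
    (hroot : ∀ v < n, ρ v = v → ∀ y < K v, B v y y ≤ B v (ψ v) (ψ v))
    (hnon : ∀ v < n, ρ v ≠ v → ∀ y < K v, B v (ψ (ρ v)) y + w v y (ψ (f v)) ≤
      B v (ψ (ρ v)) (ψ v) + w v (ψ v) (ψ (f v)))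
    (φ : ℕ → ℕ) (hφ : ∀ v < n, φ v < K v) : arcWeight n f w φ ≤ arcWeight n f w ψ := by
  have e₁ := sum_table_roots (w := w) hf hρ hρf hB φ hφ fun u _ hu => if_pos hu
  have e₂ := sum_table_roots (w := w) hf hρ hρf hB ψ hψ fun u _ hu => if_pos hu
  -- By `e₁` and `e₂`, each weight is the sum of the root entries minus the defects (message minus
  -- the term it maximizes) of the non-roots. The root entries of `φ` are at most those of `ψ`.
  have h₁ : ∑ v ∈ Finset.range n with ρ v = v, B v (φ v) (φ v) ≤
      ∑ v ∈ Finset.range n with ρ v = v, B v (ψ v) (ψ v) :=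
    Finset.sum_le_sum fun v hv => by
      obtain ⟨h1, h2⟩ := Finset.mem_filter.1 hv
      exact hroot v (Finset.mem_range.1 h1) h2 _ (hφ v (Finset.mem_range.1 h1))
  -- The defects of `φ` are nonnegative, because a message is a maximum.
  have h₂ := Finset.sum_le_sum (s := {v ∈ Finset.range n | ¬ ρ v = v})
      (f := fun v => B v (φ (ρ v)) (φ v) + w v (φ v) (φ (f v)))
      (g := fun u => if ρ u = u then w u (φ (ρ u)) (φ (f u)) else
        (Finset.range (K u)).sup fun a => B u (φ (ρ u)) a + w u a (φ (f u))) fun v hv => by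
    obtain ⟨h1, h2⟩ := Finset.mem_filter.1 hv
    simp only [if_neg h2]
    exact Finset.le_sup (f := fun a => B v (φ (ρ v)) a + w v a (φ (f v)))
      (Finset.mem_range.2 (hφ v (Finset.mem_range.1 h1)))
  -- The total defect of `ψ` is at most zero, because `ψ` attains the maxima.
  have h₃ := Finset.sum_le_sum (s := {v ∈ Finset.range n | ¬ ρ v = v})
      (f := fun u => if ρ u = u then w u (ψ (ρ u)) (ψ (f u)) else
        (Finset.range (K u)).sup fun a => B u (ψ (ρ u)) a + w u a (ψ (f u)))
      (g := fun v => B v (ψ (ρ v)) (ψ v) + w v (ψ v) (ψ (f v))) fun v hv => by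
    obtain ⟨h1, h2⟩ := Finset.mem_filter.1 hv
    simp only [if_neg h2]
    exact Finset.sup_le fun a ha => hnon v (Finset.mem_range.1 h1) h2 a (Finset.mem_range.1 ha)
  omega

end Pseudoforest

/-! ### Cycles and roots of functional graphs -/

section Roots

variable {n : ℕ} {f : ℕ → ℕ}

lemma iterate_lt (hf : ∀ v < n, f v < n) {v : ℕ} (hv : v < n) (t : ℕ) : f^[t] v < n := by
  induction t with
  | zero => exact hv
  | succ t ih => rw [Function.iterate_succ_apply']; exact hf _ ih

/-- The orbit of `v` becomes periodic within `n` steps. -/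
lemma exists_period (hf : ∀ v < n, f v < n) {v : ℕ} (hv : v < n) :
    ∃ i p : ℕ, 0 < p ∧ i + p ≤ n ∧ f^[i + p] v = f^[i] v := by
  obtain ⟨a, b, hab, heq⟩ : ∃ a b : Fin (n + 1), a ≠ b ∧
      (⟨f^[a] v, iterate_lt hf hv a⟩ : Fin n) = ⟨f^[b] v, iterate_lt hf hv b⟩ :=
    Fintype.exists_ne_map_eq_of_card_lt
      (fun a : Fin (n + 1) => (⟨f^[a] v, iterate_lt hf hv a⟩ : Fin n)) (by simp)
  have heq : f^[(a : ℕ)] v = f^[(b : ℕ)] v := by simpa using heq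
  have hne : (a : ℕ) ≠ b := fun h => hab (Fin.ext h)
  rcases lt_or_gt_of_ne hne with h | h
  · exact ⟨a, b - a, by omega, by omega, by rw [heq]; congr 2; omega⟩
  · exact ⟨b, a - b, by omega, by omega, by rw [← heq]; congr 2; omega⟩

/-- The largest vertex on the cycle that `v` leads to. -/
def cycleMax (n : ℕ) (f : ℕ → ℕ) (v : ℕ) : ℕ := (Finset.range n).sup fun t => f^[n + t] v

/-- After `n` steps the orbit is on its cycle, with a period `p ≤ n`. A time `t ≥ 2n` can therefore
be lowered by `p` and stays at least `n`, so the window of `n` times in `cycleMax` sees the whole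
cycle. -/
lemma iterate_le_cycleMax (hf : ∀ v < n, f v < n) {v : ℕ} (hv : v < n) (t : ℕ) (ht : n ≤ t) :
    f^[t] v ≤ cycleMax n f v := by
  obtain ⟨i, p, hp, hip, hper⟩ := exists_period hf hv
  have step : ∀ s, i ≤ s → f^[s + p] v = f^[s] v := by
    intro s hs
    obtain ⟨k, rfl⟩ := Nat.exists_eq_add_of_le' hs
    rw [add_assoc, Function.iterate_add_apply, hper, ← Function.iterate_add_apply]
  induction t using Nat.strong_induction_on with
  | _ t ih =>
    by_cases h : t < n + n
    · obtain ⟨k, rfl⟩ := Nat.exists_eq_add_of_le ht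
      exact Finset.le_sup (f := fun t => f^[n + t] v) (Finset.mem_range.2 (by omega))
    · have := ih (t - p) (by omega) (by omega)
      rwa [← step (t - p) (by omega), Nat.sub_add_cancel (by omega)] at this

lemma exists_iterate_eq_cycleMax {v : ℕ} (hv : v < n) :
    ∃ t, n ≤ t ∧ t < n + n ∧ f^[t] v = cycleMax n f v := by
  obtain ⟨t, ht, h⟩ := Finset.exists_eq_sup_range (by omega : 0 < n) fun t => f^[n + t] v
  exact ⟨n + t, by omega, by omega, h⟩

lemma cycleMax_apply (hf : ∀ v < n, f v < n) {v : ℕ} (hv : v < n) :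
    cycleMax n f (f v) = cycleMax n f v := by
  apply le_antisymm
  · obtain ⟨t, h1, -, h3⟩ := exists_iterate_eq_cycleMax (f := f) (hf v hv)
    rw [← h3, ← Function.iterate_succ_apply]
    exact iterate_le_cycleMax hf hv _ (by omega)
  · obtain ⟨t, h1, -, h3⟩ := exists_iterate_eq_cycleMax (f := f) hv
    obtain ⟨i, p, hp, hip, hper⟩ := exists_period hf hv
    obtain ⟨k, rfl⟩ := Nat.exists_eq_add_of_le' (by omega : i ≤ t)
    -- One more turn around the cycle turns an iterate of `v` into a late iterate of `f v`.
    have : f^[k + i] v = f^[k + i + p - 1] (f v) := by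
      rw [← Function.iterate_succ_apply, Nat.succ_eq_add_one, Nat.sub_add_cancel (by omega),
        add_assoc, Function.iterate_add_apply, Function.iterate_add_apply f k (i + p), hper]
    rw [← h3, this]
    exact iterate_le_cycleMax hf (hf v hv) _ (by omega)

lemma cycleMax_lt (hf : ∀ v < n, f v < n) {v : ℕ} (hv : v < n) : cycleMax n f v < n := by
  obtain ⟨t, -, -, h⟩ := exists_iterate_eq_cycleMax (f := f) hv
  exact h ▸ iterate_lt hf hv t

lemma cycleMax_iterate (hf : ∀ v < n, f v < n) {v : ℕ} (hv : v < n) (t : ℕ) :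
    cycleMax n f (f^[t] v) = cycleMax n f v := by
  induction t with
  | zero => rfl
  | succ t ih => rw [Function.iterate_succ_apply', cycleMax_apply hf (iterate_lt hf hv t), ih]

lemma cycleMax_cycleMax (hf : ∀ v < n, f v < n) {v : ℕ} (hv : v < n) :
    cycleMax n f (cycleMax n f v) = cycleMax n f v := by
  obtain ⟨t, -, -, h⟩ := exists_iterate_eq_cycleMax (f := f) hv
  rw [← h, cycleMax_iterate hf hv, h]

/-- The distance to the root. -/
noncomputable def rootDist (n : ℕ) (f : ℕ → ℕ) (v : ℕ) : ℕ := sInf {t | f^[t] v = cycleMax n f v}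

lemma rootDist_lt {v : ℕ} (hv : v < n) : rootDist n f v < n + n := by
  obtain ⟨t, -, h2, h⟩ := exists_iterate_eq_cycleMax (f := f) hv
  exact lt_of_le_of_lt (Nat.sInf_le (s := {t | f^[t] v = cycleMax n f v}) h) h2

/-- Cutting the cycles at the roots makes the successor relation well-founded; this is what ranks
the table entries and the values traced back. -/
lemma rootDist_apply_lt (hf : ∀ v < n, f v < n) {v : ℕ} (hv : v < n) (hne : cycleMax n f v ≠ v) :
    rootDist n f (f v) < rootDist n f v := by
  obtain ⟨t, -, -, h⟩ := exists_iterate_eq_cycleMax (f := f) hv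
  have hmem : f^[rootDist n f v] v = cycleMax n f v :=
    Nat.sInf_mem (s := {t | f^[t] v = cycleMax n f v}) ⟨t, h⟩
  obtain ⟨k, hk⟩ : ∃ k, rootDist n f v = k + 1 := by
    refine Nat.exists_eq_succ_of_ne_zero fun h0 => hne ?_
    rw [h0] at hmem; exact hmem.symm
  rw [hk, Function.iterate_succ_apply, ← cycleMax_apply hf hv] at hmem
  have : rootDist n f (f v) ≤ k := Nat.sInf_le hmem
  omega

lemma rootDist_cycleMax_lt (hf : ∀ v < n, f v < n) {v : ℕ} (hv : v < n)
    (hne : cycleMax n f v ≠ v) : rootDist n f (cycleMax n f v) < rootDist n f v := by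
  have h0 : rootDist n f (cycleMax n f v) = 0 :=
    Nat.le_zero.1 (Nat.sInf_le (by simp [cycleMax_cycleMax hf hv]))
  have := rootDist_apply_lt hf hv hne
  omega

end Roots

namespace RAM

/-! ### Reasoning about loops and arrays -/

section

variable {N : ℕ} {σ : State}

lemma State.rd_wr_other {a b i j k x i' j' k' : ℕ} (h : b ≠ a) :
    (σ.wr N a i j k x).rd N b i' j' k' = σ.rd N b i' j' k' := by
  simp [State.rd, State.wr, h]

lemma State.rd_wr {a i j k x i' j' k' : ℕ} (hi : i ≤ N) (hj : j ≤ N) (hk : k ≤ N) (hi' : i' ≤ N)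
    (hj' : j' ≤ N) (hk' : k' ≤ N) : (σ.wr N a i j k x).rd N a i' j' k' =
      if i' = i ∧ j' = j ∧ k' = k then x else σ.rd N a i' j' k' := by
  simp [State.rd, State.wr, hi, hj, hk, hi', hj', hk']

lemma State.wr_array {a b i j k x : ℕ} (h : b ≠ a) : (σ.wr N a i j k x) b = σ b := by
  funext i' j' k'
  simp [State.wr, h]

lemma State.wr_rd {a i j k : ℕ} : σ.wr N a i j k (σ.rd N a i j k) = σ := by
  funext a' i' j' k'
  simp only [State.wr, State.rd]
  split_ifs with h
  · obtain ⟨rfl, rfl, rfl, rfl⟩ := h; rfl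
  · rfl

lemma rounds_induct {body : ℕ → State → State} (Inv : ℕ → State → Prop) (m : ℕ) (h0 : Inv 0 σ)
    (hs : ∀ i < m, ∀ σ, Inv i σ → Inv (i + 1) (body i σ)) : Inv m (rounds body m σ) := by
  induction m with
  | zero => exact h0
  | succ m ih =>
    exact hs m (Nat.lt_succ_self m) _ (ih fun i hi => hs i (Nat.lt_succ_of_lt hi))

lemma forTo_induct {b : ℕ} {body : ℕ → State → State} (Inv : ℕ → State → Prop) (hb : b ≤ N)
    (h0 : Inv 0 σ) (hs : ∀ i < b, ∀ σ, Inv i σ → Inv (i + 1) (body i σ)) :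
    Inv b (forTo N b body σ) := by
  rw [forTo, min_eq_left hb]
  exact rounds_induct Inv b h0 hs

lemma sumTo_of_le {b : ℕ} (hb : b ≤ N) (f : ℕ → ℕ) : sumTo N b f = ∑ i ∈ Finset.range b, f i := by
  rw [sumTo, min_eq_left hb]

lemma supTo_of_le {b : ℕ} (hb : b ≤ N) (f : ℕ → ℕ) : supTo N b f = (Finset.range b).sup f := by
  rw [supTo, min_eq_left hb]

end

/-! Sweeps establish a system of local conditions if each condition depends only on those of
smaller rank. -/

section Sweep

variable {κ : Type*} (Inv : State → Prop) (Q : κ → State → Prop) (h : κ → ℕ)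

/-- The conditions of rank less than `t`, and those in `D` of rank `t`, are satisfied. -/
def Swept (t : ℕ) (D : Set κ) (σ : State) : Prop :=
  Inv σ ∧ (∀ k, h k < t → Q k σ) ∧ ∀ k ∈ D, h k ≤ t → Q k σ

/-- `F` establishes the conditions in `A`. -/
def Covers (t : ℕ) (F : State → State) (A : Set κ) : Prop :=
  ∀ D σ, Swept Inv Q h t D σ → Swept Inv Q h t (D ∪ A) (F σ)

variable {Inv Q h}

/-- An update that re-establishes condition `k` cannot spoil one of rank at most `t`. If `k` has
rank less than `t`, it holds already and the update changes nothing (`hid`); otherwise the other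
conditions of rank at most `t` have rank at most that of `k` and survive (`hj`). -/
lemma covers_step {t : ℕ} {F : State → State} {k : κ} (hI : ∀ σ, Inv σ → Inv (F σ))
    (hk : ∀ σ, Inv σ → Q k (F σ))
    (hj : ∀ σ j, Inv σ → h j ≤ h k → j ≠ k → Q j σ → Q j (F σ))
    (hid : ∀ σ, Inv σ → Q k σ → F σ = σ) :
    Covers Inv Q h t F {k} := by
  rintro D σ ⟨h1, h2, h3⟩
  have key : ∀ j, h j ≤ t → Q j σ → Q j (F σ) := by
    intro j hjt hQ
    by_cases hkt : h k < t
    · rwa [hid σ h1 (h2 k hkt)]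
    · by_cases hjk : j = k
      · exact hjk ▸ hk σ h1
      · exact hj σ j h1 (by omega) hjk hQ
  refine ⟨hI σ h1, fun j hjt => key j hjt.le (h2 j hjt), ?_⟩
  rintro j (hjD | hjk) hjt
  · exact key j hjt (h3 j hjD hjt)
  · rw [Set.mem_singleton_iff.1 hjk]; exact hk σ h1

lemma covers_for {t N m : ℕ} {b : State → ℕ} {body : ℕ → State → State} {A : ℕ → Set κ}
    (hm : m ≤ N) (hb : ∀ σ, Inv σ → b σ = m) (hc : ∀ i < m, Covers Inv Q h t (body i) (A i)) :
    Covers Inv Q h t (fun σ => forTo N (b σ) body σ) {k | ∃ i < m, k ∈ A i} := by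
  intro D σ hσ
  simp only [hb σ hσ.1]
  have := forTo_induct (N := N) (body := body) (σ := σ)
    (fun i σ => Swept Inv Q h t (D ∪ {k | ∃ i' < i, k ∈ A i'}) σ) hm (by simpa using hσ) ?_
  · exact this
  · intro i hi σ hσ
    refine (fun h => ?_) (hc i hi _ _ hσ)
    obtain ⟨h1, h2, h3⟩ := h
    refine ⟨h1, h2, fun k hk hkt => h3 k ?_ hkt⟩
    rcases hk with hk | ⟨i', hi', hk⟩
    · exact Or.inl (Or.inl hk)
    · rcases Nat.lt_succ_iff_lt_or_eq.1 hi' with h | rfl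
      · exact Or.inl (Or.inr ⟨i', h, hk⟩)
      · exact Or.inr hk

/-- Each sweep settles at least one more rank, so the order of the updates within a sweep is
irrelevant. Conditions outside `A` are those that hold trivially, such as those with indices out of
range. -/
lemma sweeps {N : ℕ} {F : State → State} {A : Set κ} (hc : ∀ t, Covers Inv Q h t F A)
    (hA : ∀ k, k ∉ A → ∀ σ, Inv σ → Q k σ) (hN : ∀ k, h k < N) {σ : State} (hσ : Inv σ) :
    Inv (forTo N N (fun _ => F) σ) ∧ ∀ k, Q k (forTo N N (fun _ => F) σ) := by
  have := forTo_induct (N := N) (body := fun _ => F) (σ := σ)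
    (fun t σ => Inv σ ∧ ∀ k, h k < t → Q k σ) le_rfl ⟨hσ, fun k hk => absurd hk (by omega)⟩ ?_
  · exact ⟨this.1, fun k => this.2 k (hN k)⟩
  · rintro t - σ ⟨h1, h2⟩
    obtain ⟨h3, -, h4⟩ := hc t ∅ σ ⟨h1, h2, fun k hk => absurd hk (by simp)⟩
    refine ⟨h3, fun k hk => ?_⟩
    by_cases hkA : k ∈ A
    · exact h4 k (Or.inr hkA) (by omega)
    · exact hA k hkA _ h3

end Sweep

end RAM

namespace RAM

/-! ### The algorithm -/

/-- Sequential composition. -/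
@[irreducible] def thn (F G : State → State) (σ : State) : State := G (F σ)

@[simp] lemma thn_apply (F G : State → State) (σ : State) : thn F G σ = G (F σ) := by rw [thn]

/-! Reading and writing scalars, vectors, and tables. -/

notation "r0" x:max σ:max a:max => State.rd (List.length x) σ a 0 0 0
notation "r1" x:max σ:max a:max i:max => State.rd (List.length x) σ a i 0 0
notation "r2" x:max σ:max a:max i:max j:max => State.rd (List.length x) σ a i j 0
notation "r3" x:max σ:max a:max i:max j:max k:max => State.rd (List.length x) σ a i j k
notation "w0" x:max σ:max a:max y:max => State.wr (List.length x) σ a 0 0 0 y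
notation "w1" x:max σ:max a:max i:max y:max => State.wr (List.length x) σ a i 0 0 y
notation "w2" x:max σ:max a:max i:max j:max y:max => State.wr (List.length x) σ a i j 0 y
notation "w3" x:max σ:max a:max i:max j:max k:max y:max => State.wr (List.length x) σ a i j k y

/-- Bit `i` of the input. -/
def bit (x : List Bool) (i : ℕ) : ℕ := RAM.input x 0 (i + 1)

/-- The number of ones from position `p` on, up to the next zero. -/
def run (x : List Bool) (p : ℕ) : ℕ :=
  sumTo x.length x.length fun i => 1 - sumTo x.length (i + 1) fun j => 1 - bit x (p + j)

/-- Multiplication by repeated addition. -/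
def mul (x : List Bool) (a b : ℕ) : ℕ := sumTo x.length a fun _ => b

/-! The arrays: `1` number of variables, `2` read position, `3` alphabet sizes, `4` adjacency,
`5` positions of the constraint tables, `6` colours of the arcs, `7` successors in the current
colour class, `8` auxiliary, `9` roots, `10` table of the dynamic program, `11` assignment,
`12` best value, `13` value. -/

/-- Reading the number of variables and the alphabet sizes. -/
def readSizes (x : List Bool) : State → State :=
  thn (fun σ => w0 x σ 1 (run x 0)) <|
  thn (fun σ => w0 x σ 2 (r0 x σ 1 + 1)) <|
  fun σ => forTo x.length (r0 x σ 1) (fun v =>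
    thn (fun σ => w1 x σ 3 v (run x (r0 x σ 2)))
      (fun σ => w0 x σ 2 (r0 x σ 2 + r1 x σ 3 v + 1))) σ

/-- Reading the block of a pair of variables. -/
def readPair (x : List Bool) (u v : ℕ) : State → State :=
  thn (fun σ => w2 x σ 4 u v (bit x (r0 x σ 2))) <|
  thn (fun σ => w2 x σ 4 v u (bit x (r0 x σ 2))) <|
  thn (fun σ => w2 x σ 5 u v (r0 x σ 2 + 1)) <|
  thn (fun σ => w2 x σ 5 v u (r0 x σ 2 + 1)) <|
  fun σ => w0 x σ 2 (r0 x σ 2 + 1 +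
    if 0 < r2 x σ 4 u v then mul x (r1 x σ 3 u) (r1 x σ 3 v) else 0)

/-- Reading all blocks. -/
def readPairs (x : List Bool) : State → State := fun σ =>
  forTo x.length (r0 x σ 1) (fun u σ => forTo x.length (r0 x σ 1) (fun v σ =>
    if u < v then readPair x u v σ else σ) σ) σ

/-- Whether the pair `a, b` satisfies the constraint of the arc from `u` to `v`. -/
def rel (x : List Bool) (σ : State) (u v a b : ℕ) : ℕ :=
  if u < v then bit x (r2 x σ 5 u v + mul x a (r1 x σ 3 v) + b)
  else bit x (r2 x σ 5 u v + mul x b (r1 x σ 3 u) + a)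

/-- The number of conflicts of the colour `c + 1` for the arc from `u` to `v`. -/
def conflicts (x : List Bool) (σ : State) (u v c : ℕ) : ℕ :=
  (sumTo x.length (r0 x σ 1) fun w => if r2 x σ 6 u w = c + 1 then 1 else 0) +
    if r2 x σ 6 v u = c + 1 then 1 else 0

/-- The degree of `u`. -/
def degree (x : List Bool) (σ : State) (u : ℕ) : ℕ :=
  sumTo x.length (r0 x σ 1) fun w => r2 x σ 4 u w

/-- Colouring the arcs greedily. -/
def colourArcs (x : List Bool) : State → State := fun σ =>
  forTo x.length (r0 x σ 1) (fun u σ => forTo x.length (r0 x σ 1) (fun v σ =>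
    if 0 < r2 x σ 4 u v then
      w2 x σ 6 u v (1 + supTo x.length (degree x σ u + 1) fun c =>
        if conflicts x σ u v c = 0 then c else 0)
    else σ) σ) σ

/-- The successors in the colour class `c + 1`. -/
def findSuccessors (x : List Bool) (c : ℕ) : State → State := fun σ =>
  forTo x.length (r0 x σ 1) (fun v σ => w1 x σ 7 v
    (if (sumTo x.length (r0 x σ 1) fun w => if r2 x σ 6 v w = c + 1 then 1 else 0) = 0 then v
      else supTo x.length (r0 x σ 1) fun w => if r2 x σ 6 v w = c + 1 then w else 0)) σ

/-- The root of each component: the largest vertex on its cycle. -/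
def findRoots (x : List Bool) : State → State := fun σ =>
  forTo x.length (r0 x σ 1) (fun v =>
    thn (fun σ => w0 x σ 8 v) <|
    thn (fun σ => forTo x.length (r0 x σ 1) (fun _ σ => w0 x σ 8 (r1 x σ 7 (r0 x σ 8))) σ) <|
    thn (fun σ => w1 x σ 9 v 0) <|
    fun σ => forTo x.length (r0 x σ 1) (fun _ =>
      thn (fun σ => w1 x σ 9 v (r1 x σ 9 v + (r0 x σ 8 - r1 x σ 9 v)))
        (fun σ => w0 x σ 8 (r1 x σ 7 (r0 x σ 8)))) σ) σ

/-- Whether the values `y, z` satisfy the constraint of the arc from `u` to its successor. -/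
def weight (x : List Bool) (σ : State) (u y z : ℕ) : ℕ :=
  if r1 x σ 7 u = u then 0 else rel x σ u (r1 x σ 7 u) y z

/-- The contribution of `u` to the table entry of its successor. -/
def message (x : List Bool) (σ : State) (u y z : ℕ) : ℕ :=
  if r1 x σ 9 u = u then weight x σ u y z
  else supTo x.length (r1 x σ 3 u) fun a => r3 x σ 10 u y a + weight x σ u a z

/-- The dynamic program. -/
def fillTable (x : List Bool) : State → State := fun σ =>
  forTo x.length x.length (fun _ σ => forTo x.length (r0 x σ 1) (fun v σ =>
    forTo x.length x.length (fun y σ => forTo x.length x.length (fun z σ =>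
      w3 x σ 10 v y z (sumTo x.length (r0 x σ 1) fun u =>
        if r1 x σ 7 u = v then message x σ u y z else 0)) σ) σ) σ) σ

/-- What the value `y` for `v` contributes, given the values for the root and the successor. -/
def gain (x : List Bool) (σ : State) (v y : ℕ) : ℕ :=
  if r1 x σ 9 v = v then r3 x σ 10 v y y
  else r3 x σ 10 v (r1 x σ 11 (r1 x σ 9 v)) y + weight x σ v y (r1 x σ 11 (r1 x σ 7 v))

/-- Finding an optimal assignment from the table. -/
def traceBack (x : List Bool) : State → State := fun σ =>
  forTo x.length x.length (fun _ σ => forTo x.length (r0 x σ 1) (fun v σ =>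
    w1 x σ 11 v (supTo x.length (r1 x σ 3 v) fun y =>
      if gain x σ v y = supTo x.length (r1 x σ 3 v) (fun y' => gain x σ v y') then y else 0))
    σ) σ

/-- Storing the assignment if it is the best one so far. -/
def keepBest (x : List Bool) : State → State :=
  thn (fun σ => w0 x σ 13 (sumTo x.length (r0 x σ 1) fun u => sumTo x.length (r0 x σ 1) fun v =>
    if 0 < r2 x σ 4 u v then rel x σ u v (r1 x σ 11 u) (r1 x σ 11 v) else 0)) <|
  fun σ => if r0 x σ 12 < r0 x σ 13 then
      thn (fun σ => forTo x.length (r0 x σ 1)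
        (fun v σ => σ.wr x.length 0 0 0 (v + 1) (r1 x σ 11 v)) σ)
        (fun σ => w0 x σ 12 (r0 x σ 13)) σ
    else σ

/-- The treatment of one colour class. -/
def treatColour (x : List Bool) (c : ℕ) : State → State :=
  thn (findSuccessors x c) <| thn (findRoots x) <| thn (fillTable x) <| thn (traceBack x) <|
  keepBest x

/-- The algorithm. -/
def algorithm (x : List Bool) : State → State :=
  thn (readSizes x) <| thn (readPairs x) <| thn (colourArcs x) <|
  thn (fun σ => forTo x.length (r0 x σ 1) (treatColour x) σ) <|
  fun σ => w0 x σ 0 (r0 x σ 1)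

/-! ### Polynomial running time of the algorithm -/

section

variable {E : Type} {Γ : Ctx E}

lemma CompS.thn {F G : E → State → State} (hF : CompS Γ F) (hG : CompS Γ G) :
    CompS Γ (fun e => RAM.thn (F e) (G e)) := by
  change CompS Γ (fun e σ => RAM.thn (F e) (G e) σ)
  simpa only [thn_apply] using hF.seq hG

/-- `f` is a loop variable. -/
def IsVar (Γ : Ctx E) (f : E → ℕ) : Prop := ∃ i < Γ.depth, ∀ e, f e = Γ.var e i

lemma IsVar.zero : IsVar Γ.ext (fun p => p.2) :=
  ⟨Γ.depth, Nat.lt_succ_self _, fun p => by simp [Ctx.ext]⟩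

lemma IsVar.succ {f : E → ℕ} (h : IsVar Γ f) : IsVar Γ.ext (fun p => f p.1) := by
  obtain ⟨i, hi, hf⟩ := h
  exact ⟨i, Nat.lt_succ_of_lt hi, fun p => by simp [Ctx.ext, hf, hi.ne]⟩

lemma IsVar.comp {f : E → ℕ} (h : IsVar Γ f) : CompE Γ (fun e _ => f e) := by
  obtain ⟨i, hi, hf⟩ := h
  simpa only [hf] using CompE.var i hi

lemma CompE.v0 : CompE Γ.ext (fun p _ => p.2) := IsVar.zero.comp
lemma CompE.v1 : CompE Γ.ext.ext (fun p _ => p.1.2) := IsVar.zero.succ.comp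
lemma CompE.v2 : CompE Γ.ext.ext.ext (fun p _ => p.1.1.2) := IsVar.zero.succ.succ.comp
lemma CompE.v3 : CompE Γ.ext.ext.ext.ext (fun p _ => p.1.1.1.2) := IsVar.zero.succ.succ.succ.comp

lemma CompE.bit {x : E → List Bool} {f : E → State → ℕ} (hf : CompE Γ f)
    (hx : ∀ e, x e = Γ.word e) : CompE Γ (fun e σ => RAM.bit (x e) (f e σ)) := by
  simp only [hx]
  exact (hf.add (CompE.lit 1)).input

lemma CompE.length' {x : E → List Bool} (hx : ∀ e, x e = Γ.word e) :
    CompE Γ (fun e _ => (x e).length) := by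
  simp only [hx]
  exact CompE.length

lemma readSizes_comp : CompS Ctx.base readSizes := by
  unfold readSizes run
  apply_rules (maxDepth := 1000) [CompS.thn, CompS.for, CompS.set, CompS.ite_lt, CompS.skip,
    CompE.rd, CompE.sum, CompE.sup, CompE.ite_eq, CompE.ite_lt, CompE.add, CompE.sub,
    CompE.bit, CompE.length', CompE.v0, CompE.v1, CompE.v2, CompE.v3, CompE.lit] <;> (intros; rfl)

lemma readPairs_comp : CompS Ctx.base readPairs := by
  unfold readPairs readPair mul
  apply_rules (maxDepth := 1000) [CompS.thn, CompS.for, CompS.set, CompS.ite_lt, CompS.skip,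
    CompE.rd, CompE.sum, CompE.sup, CompE.ite_eq, CompE.ite_lt, CompE.add, CompE.sub,
    CompE.bit, CompE.length', CompE.v0, CompE.v1, CompE.v2, CompE.v3, CompE.lit] <;> (intros; rfl)

lemma colourArcs_comp : CompS Ctx.base colourArcs := by
  unfold colourArcs conflicts degree
  apply_rules (maxDepth := 1000) [CompS.thn, CompS.for, CompS.set, CompS.ite_lt, CompS.skip,
    CompE.rd, CompE.sum, CompE.sup, CompE.ite_eq, CompE.ite_lt, CompE.add, CompE.sub,
    CompE.bit, CompE.length', CompE.v0, CompE.v1, CompE.v2, CompE.v3, CompE.lit] <;> (intros; rfl)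

lemma findSuccessors_comp : CompS Ctx.base.ext (fun e => findSuccessors e.1 e.2) := by
  unfold findSuccessors
  apply_rules (maxDepth := 1000) [CompS.thn, CompS.for, CompS.set, CompS.ite_lt, CompS.skip,
    CompE.rd, CompE.sum, CompE.sup, CompE.ite_eq, CompE.ite_lt, CompE.add, CompE.sub,
    CompE.bit, CompE.length', CompE.v0, CompE.v1, CompE.v2, CompE.v3, CompE.lit] <;> (intros; rfl)

lemma findRoots_comp : CompS Ctx.base.ext (fun e => findRoots e.1) := by
  unfold findRoots
  apply_rules (maxDepth := 1000) [CompS.thn, CompS.for, CompS.set, CompS.ite_lt, CompS.skip,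
    CompE.rd, CompE.sum, CompE.sup, CompE.ite_eq, CompE.ite_lt, CompE.add, CompE.sub,
    CompE.bit, CompE.length', CompE.v0, CompE.v1, CompE.v2, CompE.v3, CompE.lit] <;> (intros; rfl)

lemma fillTable_comp : CompS Ctx.base.ext (fun e => fillTable e.1) := by
  unfold fillTable message weight rel mul
  apply_rules (maxDepth := 1000) [CompS.thn, CompS.for, CompS.set, CompS.ite_lt, CompS.skip,
    CompE.rd, CompE.sum, CompE.sup, CompE.ite_eq, CompE.ite_lt, CompE.add, CompE.sub,
    CompE.bit, CompE.length', CompE.v0, CompE.v1, CompE.v2, CompE.v3, CompE.lit] <;> (intros; rfl)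

lemma traceBack_comp : CompS Ctx.base.ext (fun e => traceBack e.1) := by
  unfold traceBack gain weight rel mul
  apply_rules (maxDepth := 1000) [CompS.thn, CompS.for, CompS.set, CompS.ite_lt, CompS.skip,
    CompE.rd, CompE.sum, CompE.sup, CompE.ite_eq, CompE.ite_lt, CompE.add, CompE.sub,
    CompE.bit, CompE.length', CompE.v0, CompE.v1, CompE.v2, CompE.v3, CompE.lit] <;> (intros; rfl)

lemma keepBest_comp : CompS Ctx.base.ext (fun e => keepBest e.1) := by
  unfold keepBest rel mul
  apply_rules (maxDepth := 1000) [CompS.thn, CompS.for, CompS.set, CompS.ite_lt, CompS.skip,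
    CompE.rd, CompE.sum, CompE.sup, CompE.ite_eq, CompE.ite_lt, CompE.add, CompE.sub,
    CompE.bit, CompE.length', CompE.v0, CompE.v1, CompE.v2, CompE.v3, CompE.lit] <;> (intros; rfl)

lemma algorithm_comp : CompS Ctx.base algorithm := by
  unfold algorithm treatColour
  apply_rules (maxDepth := 1000) [readSizes_comp, readPairs_comp, colourArcs_comp,
    findSuccessors_comp, findRoots_comp, fillTable_comp, traceBack_comp, keepBest_comp, CompS.thn,
    CompS.for, CompS.set, CompE.rd, CompE.lit] <;> (intros; rfl)

end

end RAM

/-! ### Reading the input -/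

/-- Row-major indexing, used for looking up a truth table. -/
lemma List.getElem?_flatMap_uniform {α β : Type*} (f : α → List β) (l : ℕ) (L : List α)
    (hf : ∀ a, (f a).length = l) (i : ℕ) (hi : i < L.length) (b : ℕ) (hb : b < l) :
    (L.flatMap f)[i * l + b]? = (f L[i])[b]? := by
  induction L generalizing i with
  | nil => simp at hi
  | cons a L ih =>
    rw [List.flatMap_cons]
    cases i with
    | zero =>
      rw [zero_mul, zero_add, List.getElem?_append_left (by rw [hf]; exact hb)]; rfl
    | succ i =>
      rw [List.getElem?_append_right (by rw [hf, Nat.succ_mul]; omega), hf,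
        show (i + 1) * l + b - l = i * l + b by rw [Nat.succ_mul]; omega]
      exact ih i (by simpa using hi)

lemma List.drop_finRange {n : ℕ} (i : Fin n) :
    (List.finRange n).drop i = i :: (List.finRange n).drop (i + 1) := by
  rw [List.drop_eq_getElem_cons (by simp)]
  simp

lemma List.drop_add_length {α : Type*} {x l r : List α} {p : ℕ} (h : x.drop p = l ++ r) :
    x.drop (p + l.length) = r := by
  rw [← List.drop_drop, h, List.drop_left]

namespace RAM

section

variable {x : List Bool}

lemma bit_drop {p : ℕ} {l : List Bool} (h : x.drop p = l) (j : ℕ) :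
    bit x (p + j) = (l[j]?.getD false).toNat := by
  subst h
  simp [bit, RAM.input, List.getD_eq_getElem?_getD]

lemma mul_eq {a b : ℕ} (ha : a ≤ x.length) : mul x a b = a * b := by
  rw [mul, sumTo_of_le ha]; simp

lemma run_eq {p m : ℕ} {r : List Bool} (h : x.drop p = TwoCSP.unary m ++ r) : run x p = m := by
  have hlen : m < x.length := by
    have := congrArg List.length h
    simp [TwoCSP.unary] at this
    omega
  have h1 : ∀ j < m, bit x (p + j) = 1 := by
    intro j hj
    rw [bit_drop h]
    simp [TwoCSP.unary, List.getElem?_append, hj]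
  have h0 : bit x (p + m) = 0 := by
    rw [bit_drop h]
    simp [TwoCSP.unary]
  -- The summand for `i` is `1` precisely when none of the bits `p, …, p + i` is zero.
  have key : ∀ i ∈ Finset.range x.length,
      1 - sumTo x.length (i + 1) (fun j => 1 - bit x (p + j)) = if i < m then 1 else 0 := by
    intro i hi
    rw [sumTo_of_le (show i + 1 ≤ x.length from Finset.mem_range.1 hi)]
    split_ifs with him
    · rw [Finset.sum_eq_zero fun j hj => by
        rw [h1 j (by have := Finset.mem_range.1 hj; omega), Nat.sub_self], Nat.sub_zero]
    · have := Finset.single_le_sum (f := fun j => 1 - bit x (p + j)) (fun _ _ => Nat.zero_le _)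
        (Finset.mem_range.2 (by omega : m < i + 1))
      rw [h0] at this
      omega
  rw [run, sumTo_of_le le_rfl, Finset.sum_congr rfl key, ← Finset.sum_filter, Finset.sum_const,
    smul_eq_mul, mul_one]
  have : (Finset.range x.length).filter (· < m) = Finset.range m := by
    ext i; simp; omega
  rw [this, Finset.card_range]

end

section

variable {n : ℕ} {k : Fin n → ℕ} (I : TwoCSP (Fin n) (fun v => Fin (k v)))

/-- The part of the encoding that belongs to the pair `u, v`. -/
noncomputable def pairBlock (u v : Fin n) : List Bool :=
  if u < v then TwoCSP.encodePair I u v else []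

lemma encode_eq : I.encode = TwoCSP.unary n ++
    (List.finRange n).flatMap (fun v => TwoCSP.unary (k v)) ++
      (List.finRange n).flatMap fun u => (List.finRange n).flatMap (pairBlock I u) := rfl

/-- The unary `n` takes `n + 1` bits, and each of the `n` alphabet sizes takes at least its
terminating zero. The ranks in the sweeps are at most `2n`, so `N` sweeps suffice. -/
lemma length_encode : n + n < I.encode.length := by
  have : n ≤ ((List.finRange n).flatMap (fun v => TwoCSP.unary (k v))).length := by
    rw [List.length_flatMap]
    have := List.length_le_sum_of_one_le
      ((List.finRange n).map fun v => (TwoCSP.unary (k v)).length)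
      (by intro i hi; obtain ⟨v, -, rfl⟩ := List.mem_map.1 hi; simp [TwoCSP.unary])
    simpa using this
  rw [encode_eq, List.length_append, List.length_append]
  simp only [TwoCSP.unary, List.length_append, List.length_replicate,
    List.length_singleton] at this ⊢
  omega

lemma alphabet_le_length (v : Fin n) : k v ≤ I.encode.length := by
  have h1 : (TwoCSP.unary (k v)).length ≤
      ((List.finRange n).flatMap (fun v => TwoCSP.unary (k v))).length :=
    (List.sublist_flatten_of_mem (List.mem_map_of_mem (f := fun v => TwoCSP.unary (k v))
      (List.mem_finRange v))).length_le
  rw [encode_eq, List.length_append, List.length_append]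
  simp only [TwoCSP.unary, List.length_append, List.length_replicate, List.length_singleton] at h1 ⊢
  omega

/-- The state after reading the alphabet sizes. -/
structure SizesRead (σ : State) (i : ℕ) : Prop where
  num : r0 I.encode σ 1 = n
  size : ∀ v : Fin n, (v : ℕ) < i → r1 I.encode σ 3 v = k v
  ptr : I.encode.drop (r0 I.encode σ 2) =
    ((List.finRange n).drop i).flatMap (fun v => TwoCSP.unary (k v)) ++
      (List.finRange n).flatMap fun u => (List.finRange n).flatMap (pairBlock I u)
  other : ∀ a, 3 < a → σ a = fun _ _ _ => 0

lemma readSizes_spec : SizesRead I (readSizes I.encode (fun _ _ _ _ => 0)) n := by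
  have hN := length_encode I
  have hrun : run I.encode 0 = n :=
    run_eq (r := (List.finRange n).flatMap (fun v => TwoCSP.unary (k v)) ++
      (List.finRange n).flatMap fun u => (List.finRange n).flatMap (pairBlock I u)) (by
        rw [List.drop_zero, encode_eq, List.append_assoc])
  simp only [readSizes, thn_apply]
  set σ₀ : State := w0 I.encode (w0 I.encode (fun _ _ _ _ => 0) 1 (run I.encode 0)) 2
    (r0 I.encode (w0 I.encode (fun _ _ _ _ => 0) 1 (run I.encode 0)) 1 + 1) with hσ₀
  have e1 : r0 I.encode σ₀ 1 = n := by
    simp [hσ₀, State.rd_wr_other, State.rd_wr, hrun]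
  have e2 : r0 I.encode σ₀ 2 = n + 1 := by
    simp [hσ₀, State.rd_wr, hrun]
  rw [e1]
  refine forTo_induct (fun i σ => SizesRead I σ i) (by omega) ⟨e1, fun v hv => absurd hv (by omega),
    ?_, ?_⟩ ?_
  · rw [e2, List.drop_zero]
    have : I.encode.drop 0 = TwoCSP.unary n ++
      ((List.finRange n).flatMap (fun v => TwoCSP.unary (k v)) ++
      (List.finRange n).flatMap fun u => (List.finRange n).flatMap (pairBlock I u)) := by
        rw [List.drop_zero, encode_eq, List.append_assoc]
    have h := List.drop_add_length this
    simpa [TwoCSP.unary] using h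
  · intro a ha
    rw [hσ₀, State.wr_array (by omega), State.wr_array (by omega)]
  · intro i hi σ ⟨h1, h2, h3, h4⟩
    rw [thn_apply]
    have hd := List.drop_finRange (⟨i, hi⟩ : Fin n)
    simp only at hd
    rw [hd, List.flatMap_cons, List.append_assoc] at h3
    have hr := run_eq h3
    have hd' := List.drop_add_length h3
    refine ⟨?_, ?_, ?_, ?_⟩
    · simp [State.rd_wr_other, h1]
    · intro v hv
      simp only [State.rd_wr_other (show (3 : ℕ) ≠ 2 by decide)]
      rw [State.rd_wr (by omega) (by omega) (by omega) (by omega) (by omega) (by omega)]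
      split_ifs with hvi
      · rw [hr]; congr 1; exact Fin.ext hvi.1.symm
      · exact h2 v (by omega)
    · rw [← hd']
      congr 1
      rw [State.rd_wr (by omega) (by omega) (by omega) (by omega) (by omega) (by omega),
        if_pos (by simp)]
      rw [State.rd_wr_other (show (2 : ℕ) ≠ 3 by decide),
        State.rd_wr (by omega) (by omega) (by omega) (by omega) (by omega) (by omega),
        if_pos (by simp), hr]
      simp [TwoCSP.unary, add_assoc]
    · intro a ha
      rw [State.wr_array (by omega), State.wr_array (by omega), h4 a ha]

open Classical in
/-- The state `σ` describes the instance `I`. -/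
structure Describes (σ : State) : Prop where
  num : r0 I.encode σ 1 = n
  size : ∀ v : Fin n, r1 I.encode σ 3 v = k v
  adj : ∀ u v : Fin n, r2 I.encode σ 4 u v = if I.graph.Adj u v then 1 else 0
  rel : ∀ (u v : Fin n) (h : I.graph.Adj u v) (a : Fin (k u)) (b : Fin (k v)),
    RAM.rel I.encode σ u v a b = if (a, b) ∈ I.rel h then 1 else 0

open Classical in
/-- The block of the pair `u, v`, where `u < v`, has been read. -/
structure PairRead (σ : State) (u v : Fin n) : Prop where
  adj : r2 I.encode σ 4 u v = if I.graph.Adj u v then 1 else 0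
  adj' : r2 I.encode σ 4 v u = if I.graph.Adj u v then 1 else 0
  pos : r2 I.encode σ 5 u v = r2 I.encode σ 5 v u
  table : ∀ h : I.graph.Adj u v, ∃ r, I.encode.drop (r2 I.encode σ 5 u v) =
    ((List.finRange (k u)).flatMap fun a =>
      (List.finRange (k v)).map fun b => decide ((a, b) ∈ I.rel h)) ++ r

/-- The state when the pairs before `u, v` have been read. -/
structure PairsRead (σ : State) (i j : ℕ) : Prop where
  num : r0 I.encode σ 1 = n
  size : ∀ v : Fin n, r1 I.encode σ 3 v = k v
  diag : ∀ v : Fin n, r2 I.encode σ 4 v v = 0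
  pair : ∀ u v : Fin n, u < v → ((u : ℕ) < i ∨ ((u : ℕ) = i ∧ (v : ℕ) < j)) → PairRead I σ u v
  other : ∀ a, 5 < a → σ a = fun _ _ _ => 0

open Classical in
-- Entry `(a, b)` is bit `a * k v + b` of the table. Multiplication is a loop of `a` rounds, which
-- is not truncated since `a < k u ≤ N`.
lemma rel_of_table {σ : State} (hs : ∀ v : Fin n, r1 I.encode σ 3 v = k v) {u v : Fin n}
    (h : PairRead I σ u v) (hadj : I.graph.Adj u v) (a : Fin (k u)) (b : Fin (k v)) :
    bit I.encode (r2 I.encode σ 5 u v + mul I.encode a (r1 I.encode σ 3 v) + b) =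
      if (a, b) ∈ I.rel hadj then 1 else 0 := by
  obtain ⟨r, hr⟩ := h.table hadj
  have hk := alphabet_le_length I u
  have hlen : ((List.finRange (k u)).flatMap fun a =>
      (List.finRange (k v)).map fun b => decide ((a, b) ∈ I.rel hadj)).length = k u * k v := by
    simp [List.length_flatMap]
  have hlt : (a : ℕ) * k v + b < k u * k v := by
    calc (a : ℕ) * k v + b < a * k v + k v := by omega
      _ = (a + 1) * k v := by ring
      _ ≤ k u * k v := Nat.mul_le_mul_right _ a.2
  rw [mul_eq (by omega), hs v, add_assoc, bit_drop hr,
    List.getElem?_append_left (by rw [hlen]; exact hlt),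
    List.getElem?_flatMap_uniform _ (k v) _ (by simp) a (by simp) b b.2]
  by_cases hab : (a, b) ∈ I.rel hadj <;> simp [hab]

open Classical in
variable {I} in
lemma PairsRead.describes {σ : State} {j : ℕ} (h : PairsRead I σ n j) : Describes I σ where
  num := h.num
  size := h.size
  adj u v := by
    rcases lt_trichotomy u v with huv | rfl | huv
    · exact (h.pair u v huv (Or.inl u.2)).adj
    · simp [h.diag]
    · rw [(h.pair v u huv (Or.inl v.2)).adj', I.graph.adj_comm]
  rel u v hadj a b := by
    rcases lt_trichotomy u v with huv | rfl | huv
    · rw [RAM.rel, if_pos (by exact huv)]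
      exact rel_of_table I h.size (h.pair u v huv (Or.inl u.2)) hadj a b
    · exact absurd hadj (I.graph.loopless.irrefl u)
    · have hp := h.pair v u huv (Or.inl v.2)
      rw [RAM.rel, if_neg (by have : (v : ℕ) < u := huv; omega), ← hp.pos,
        rel_of_table I h.size hp hadj.symm b a]
      exact if_congr (I.rel_symm hadj a b).symm rfl rfl

open Classical in
-- The read position always points at the unread remainder of the encoding, so consuming one block
-- leaves `r`.
lemma readPair_spec {σ : State} {u v : Fin n} (huv : u < v) {r : List Bool}
    (h : PairsRead I σ u v) (hp : I.encode.drop (r0 I.encode σ 2) = TwoCSP.encodePair I u v ++ r) :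
    PairsRead I (readPair I.encode u v σ) u (v + 1) ∧
      I.encode.drop (r0 I.encode (readPair I.encode u v σ) 2) = r := by
  have hN := length_encode I
  have huv' : (u : ℕ) < v := huv
  set p := r0 I.encode σ 2 with hpdef
  have hbit : bit I.encode p = if I.graph.Adj u v then 1 else 0 := by
    have := bit_drop hp 0
    rw [add_zero] at this
    rw [this, TwoCSP.encodePair]
    split_ifs <;> simp
  set σ' := readPair I.encode u v σ with hσ'
  simp only [readPair, thn_apply] at hσ'
  have b4 : ∀ i j : Fin n, r2 I.encode σ' 4 i j =
      if i = u ∧ j = v ∨ i = v ∧ j = u then bit I.encode p else r2 I.encode σ 4 i j := by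
    intro i j
    rw [hσ']
    simp only [State.rd_wr_other (show (4 : ℕ) ≠ 2 by decide),
      State.rd_wr_other (show (4 : ℕ) ≠ 5 by decide),
      State.rd_wr_other (show (2 : ℕ) ≠ 4 by decide)]
    repeat rw [State.rd_wr (by omega) (by omega) (by omega) (by omega) (by omega) (by omega)]
    simp only [Fin.ext_iff, and_true]
    split_ifs <;> first | rfl | omega
  have b5 : ∀ i j : Fin n, r2 I.encode σ' 5 i j =
      if i = u ∧ j = v ∨ i = v ∧ j = u then p + 1 else r2 I.encode σ 5 i j := by
    intro i j
    rw [hσ']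
    simp only [State.rd_wr_other (show (5 : ℕ) ≠ 2 by decide),
      State.rd_wr_other (show (2 : ℕ) ≠ 5 by decide),
      State.rd_wr_other (show (2 : ℕ) ≠ 4 by decide)]
    repeat rw [State.rd_wr (by omega) (by omega) (by omega) (by omega) (by omega) (by omega)]
    simp only [Fin.ext_iff, and_true]
    split_ifs <;> first | rfl | omega
  have b1 : r0 I.encode σ' 1 = n := by
    refine Eq.trans ?_ h.num
    rw [hσ']
    simp [State.rd_wr_other]
  have b3 : ∀ w : Fin n, r1 I.encode σ' 3 w = k w := by
    intro w
    rw [hσ', ← h.size w]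
    simp [State.rd_wr_other]
  have b2 : r0 I.encode σ' 2 = p + 1 + if I.graph.Adj u v then k u * k v else 0 := by
    -- The read position advances over a truth table only if the bit just stored says that there is
    -- an edge.
    have e4 : r2 I.encode σ' 4 u v = if I.graph.Adj u v then 1 else 0 := by
      rw [b4, if_pos (Or.inl ⟨rfl, rfl⟩), hbit]
    rw [hσ'] at e4 ⊢
    rw [State.rd_wr_other (show (4 : ℕ) ≠ 2 by decide)] at e4
    rw [State.rd_wr (by omega) (by omega) (by omega) (by omega) (by omega) (by omega),
      if_pos ⟨rfl, rfl, rfl⟩, e4]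
    simp only [State.rd_wr_other (show (2 : ℕ) ≠ 4 by decide),
      State.rd_wr_other (show (2 : ℕ) ≠ 5 by decide),
      State.rd_wr_other (show (3 : ℕ) ≠ 4 by decide),
      State.rd_wr_other (show (3 : ℕ) ≠ 5 by decide)]
    rw [h.size, h.size, mul_eq (alphabet_le_length I u)]
    split_ifs <;> simp_all
  refine ⟨⟨b1, b3, ?_, ?_, ?_⟩, ?_⟩
  · intro w
    rw [b4, if_neg, h.diag]
    rintro (⟨rfl, rfl⟩ | ⟨rfl, rfl⟩) <;> omega
  · intro i j hij hlt
    by_cases hc : i = u ∧ j = v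
    · obtain ⟨rfl, rfl⟩ := hc
      refine ⟨by rw [b4, if_pos (Or.inl ⟨rfl, rfl⟩), hbit],
        by rw [b4, if_pos (Or.inr ⟨rfl, rfl⟩), hbit],
        by rw [b5, b5, if_pos (Or.inl ⟨rfl, rfl⟩), if_pos (Or.inr ⟨rfl, rfl⟩)], fun hadj => ?_⟩
      refine ⟨r, ?_⟩
      rw [b5, if_pos (Or.inl ⟨rfl, rfl⟩)]
      rw [TwoCSP.encodePair, dif_pos hadj, List.cons_append, ← List.singleton_append] at hp
      simpa using List.drop_add_length hp
    · have hc' : ¬ (i = v ∧ j = u) := by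
        rintro ⟨rfl, rfl⟩
        exact absurd hij (not_lt.2 huv.le)
      have hij' : ¬ (j = u ∧ i = v) := fun h => hc' ⟨h.2, h.1⟩
      have hij'' : ¬ (j = v ∧ i = u) := fun h => hc ⟨h.2, h.1⟩
      obtain ⟨a1, a2, a3, a4⟩ := h.pair i j hij (by
        rcases hlt with hlt | ⟨h1, h2⟩
        · exact Or.inl hlt
        · refine Or.inr ⟨h1, lt_of_le_of_ne (Nat.lt_succ_iff.1 h2) fun h3 => ?_⟩
          exact hc ⟨Fin.ext h1, Fin.ext h3⟩)
      refine ⟨by rw [b4, if_neg (by tauto), a1], by rw [b4, if_neg (by tauto), a2],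
        by rw [b5, b5, if_neg (by tauto), if_neg (by tauto), a3], fun hadj => ?_⟩
      rw [b5, if_neg (by tauto)]
      exact a4 hadj
  · intro a ha
    rw [hσ']
    repeat rw [State.wr_array (by omega)]
    exact h.other a ha
  · rw [b2]
    have hl : (TwoCSP.encodePair I u v).length = 1 + if I.graph.Adj u v then k u * k v else 0 := by
      rw [TwoCSP.encodePair]
      split_ifs
      · simp [List.length_flatMap, add_comm]
      · rfl
    have := List.drop_add_length hp
    rwa [hl, ← add_assoc] at this

lemma readPairs_spec {σ : State} (h : SizesRead I σ n) :
    Describes I (readPairs I.encode σ) ∧ ∀ a, 5 < a → readPairs I.encode σ a = fun _ _ _ => 0 := by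
  have hN := length_encode I
  have key := forTo_induct (N := I.encode.length) (σ := σ) (b := n)
    (body := fun u σ => forTo I.encode.length (r0 I.encode σ 1) (fun v σ =>
      if u < v then readPair I.encode u v σ else σ) σ)
    (fun i σ => PairsRead I σ i 0 ∧ I.encode.drop (r0 I.encode σ 2) =
      ((List.finRange n).drop i).flatMap fun u => (List.finRange n).flatMap (pairBlock I u))
    (by omega) ?_ ?_
  · rw [readPairs, h.num]
    exact ⟨key.1.describes, key.1.other⟩
  · refine ⟨⟨h.num, fun v => h.size v v.2, fun v => ?_, fun u v _ hlt => by omega,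
      fun a ha => h.other a (by omega)⟩, ?_⟩
    · simp [State.rd, h.other 4 (by omega)]
    · rw [h.ptr, List.drop_of_length_le (by simp)]; rfl
  · rintro i hi σ ⟨h1, h2⟩
    have hd := List.drop_finRange (⟨i, hi⟩ : Fin n)
    simp only at hd
    rw [hd, List.flatMap_cons] at h2
    have key := forTo_induct (N := I.encode.length) (σ := σ) (b := n)
      (body := fun v σ => if i < v then readPair I.encode i v σ else σ)
      (fun j σ => PairsRead I σ i j ∧ I.encode.drop (r0 I.encode σ 2) =
        ((List.finRange n).drop j).flatMap (pairBlock I ⟨i, hi⟩) ++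
        ((List.finRange n).drop (i + 1)).flatMap fun u => (List.finRange n).flatMap (pairBlock I u))
      (by omega) ⟨h1, h2⟩ ?_
    · simp only [h1.num]
      obtain ⟨g1, g2⟩ := key
      refine ⟨⟨g1.num, g1.size, g1.diag, fun u v huv hlt => g1.pair u v huv ?_, g1.other⟩, ?_⟩
      · have := v.2
        omega
      · rw [g2, List.drop_of_length_le (by simp)]; rfl
    · rintro j hj σ ⟨g1, g2⟩
      have hd := List.drop_finRange (⟨j, hj⟩ : Fin n)
      simp only at hd
      rw [hd, List.flatMap_cons, List.append_assoc] at g2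
      split_ifs with hij
      · rw [pairBlock, if_pos (by exact hij)] at g2
        exact readPair_spec I (u := ⟨i, hi⟩) (v := ⟨j, hj⟩) hij g1 g2
      · rw [pairBlock, if_neg (by exact hij), List.nil_append] at g2
        refine ⟨⟨g1.num, g1.size, g1.diag, fun u v huv hlt => g1.pair u v huv ?_, g1.other⟩, g2⟩
        have : (u : ℕ) < v := huv
        omega

end

end RAM

namespace RAM

/-! ### Correctness of the phases -/

section

variable {N : ℕ} {σ : State}

lemma forTo_array {b a : ℕ} {body : ℕ → State → State} (h : ∀ i σ, body i σ a = σ a) :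
    forTo N b body σ a = σ a := by
  rw [forTo]
  exact rounds_induct (fun _ σ' => σ' a = σ a) _ rfl fun i _ σ' hσ' => (h i σ').trans hσ'

lemma State.rd_congr {σ' : State} {a : ℕ} (h : σ' a = σ a) (i j k : ℕ) :
    σ'.rd N a i j k = σ.rd N a i j k := by
  simp only [State.rd, h]

/-- A loop that fills a vector. -/
lemma forTo_fill {n a : ℕ} (g : ℕ → State → ℕ) (hn : n ≤ N)
    (hg : ∀ v < n, ∀ σ', (∀ b, b ≠ a → σ' b = σ b) → g v σ' = g v σ) :
    ∀ v < n, (forTo N n (fun v σ => σ.wr N a v 0 0 (g v σ)) σ).rd N a v 0 0 = g v σ := by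
  refine (forTo_induct (N := N) (σ := σ) (body := fun v σ => σ.wr N a v 0 0 (g v σ))
    (fun i σ' => (∀ b, b ≠ a → σ' b = σ b) ∧ ∀ v < i, σ'.rd N a v 0 0 = g v σ) hn
    ⟨fun _ _ => rfl, fun v hv => absurd hv (by omega)⟩ ?_).2
  rintro i hi σ' ⟨h1, h2⟩
  refine ⟨fun b hb => by rw [State.wr_array hb, h1 b hb], fun v hv => ?_⟩
  rw [State.rd_wr (by omega) (by omega) (by omega) (by omega) (by omega) (by omega)]
  split_ifs with h
  · rw [hg i hi σ' h1, h.1]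
  · exact h2 v (by omega)

end

/-- The state `σ` describes an instance with `n` variables, alphabet sizes `K`, adjacency `A` and
constraints `R`. -/
structure Fixed (x : List Bool) (n : ℕ) (K : ℕ → ℕ) (A : ℕ → ℕ → ℕ) (R : ℕ → ℕ → ℕ → ℕ → ℕ)
    (σ : State) : Prop where
  num : r0 x σ 1 = n
  size : ∀ v, r1 x σ 3 v = K v
  adj : ∀ u v, r2 x σ 4 u v = A u v
  rel : ∀ u v a b, RAM.rel x σ u v a b = R u v a b

variable {x : List Bool} {n : ℕ} {K : ℕ → ℕ} {A C : ℕ → ℕ → ℕ} {R : ℕ → ℕ → ℕ → ℕ → ℕ} {σ : State}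

lemma Fixed.of_eq {σ' : State} (h : Fixed x n K A R σ) (h1 : σ' 1 = σ 1) (h3 : σ' 3 = σ 3)
    (h4 : σ' 4 = σ 4) (h5 : σ' 5 = σ 5) : Fixed x n K A R σ' where
  num := by rw [← h.num, State.rd_congr h1]
  size v := by rw [← h.size v, State.rd_congr h3]
  adj u v := by rw [← h.adj u v, State.rd_congr h4]
  rel u v a b := by
    rw [← h.rel u v a b]
    simp only [RAM.rel, State.rd, h3, h5]

/-- A colouring of the arcs, with colours `1, 2, …` and with `0` for uncoloured arcs and for pairs
that are not arcs: arcs with the same tail, and opposite arcs, have different colours. -/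
structure ArcColouring (n : ℕ) (A C : ℕ → ℕ → ℕ) : Prop where
  adj : ∀ u < n, ∀ v < n, C u v ≠ 0 → A u v ≠ 0
  le : ∀ u < n, ∀ v < n, C u v ≤ (∑ w ∈ Finset.range n, A u w) + 1
  out : ∀ u < n, ∀ v < n, ∀ w < n, C u v ≠ 0 → C u w = C u v → w = v
  rev : ∀ u < n, ∀ v < n, C u v ≠ 0 → C v u ≠ C u v

/-- There is a free colour. -/
lemma exists_free_colour (hA : ∀ u < n, ∀ v < n, A u v ≤ 1) (hC : ArcColouring n A C) {u v : ℕ}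
    (hu : u < n) (hv : v < n) (huv : A u v ≠ 0) (h0 : C u v = 0) :
    ∃ c < (∑ w ∈ Finset.range n, A u w) + 1, (∀ w < n, C u w ≠ c + 1) ∧ C v u ≠ c + 1 := by
  classical
  set D := (Finset.range n).filter fun w => A u w ≠ 0 with hD
  have hcard : ∑ w ∈ Finset.range n, A u w = D.card := by
    rw [hD, Finset.card_filter]
    refine Finset.sum_congr rfl fun w hw => ?_
    have := hA u hu w (Finset.mem_range.1 hw)
    split_ifs <;> omega
  have hvD : v ∈ D := by simp [hD, hv, huv]
  -- The forbidden values of `c`, where the colour is `c + 1`: at most `D.card - 1` from the other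
  -- arcs out of `u`, and one from the reverse arc. An uncoloured arc merely adds the value `0`.
  set U := (D.erase v).image (fun w => C u w - 1) ∪ {C v u - 1} with hU
  have hUcard : U.card < (Finset.range (D.card + 1)).card := by
    rw [Finset.card_range]
    have h1 := Finset.card_union_le ((D.erase v).image (fun w => C u w - 1)) {C v u - 1}
    have h2 : ((D.erase v).image (fun w => C u w - 1)).card ≤ (D.erase v).card :=
      Finset.card_image_le
    have h3 := Finset.card_erase_of_mem hvD
    have h4 : 0 < D.card := Finset.card_pos.2 ⟨v, hvD⟩
    rw [Finset.card_singleton, ← hU] at h1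
    omega
  obtain ⟨c, hc, hcU⟩ := Finset.exists_mem_notMem_of_card_lt_card hUcard
  refine ⟨c, by rw [hcard]; exact Finset.mem_range.1 hc, fun w hw h => hcU ?_, fun h => hcU ?_⟩
  · refine Finset.mem_union_left _ (Finset.mem_image.2 ⟨w, ?_, by omega⟩)
    refine Finset.mem_erase.2 ⟨?_, ?_⟩
    · rintro rfl; omega
    · rw [hD]
      exact Finset.mem_filter.2 ⟨Finset.mem_range.2 hw, hC.adj u hu w hw (by omega)⟩
  · exact Finset.mem_union_right _ (by simp [h])

/-- Colouring one more arc. -/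
lemma ArcColouring.update (hC : ArcColouring n A C) {u v c : ℕ} (huv : A u v ≠ 0)
    (hc : c < (∑ w ∈ Finset.range n, A u w) + 1) (hout : ∀ w < n, C u w ≠ c + 1)
    (hrev : C v u ≠ c + 1) (hne : u ≠ v) :
    ArcColouring n A (fun i j => if i = u ∧ j = v then 1 + c else C i j) where
  adj i hi j hj h := by
    by_cases hij : i = u ∧ j = v
    · rw [hij.1, hij.2]; exact huv
    · rw [if_neg hij] at h; exact hC.adj i hi j hj h
  le i hi j hj := by
    split_ifs with hij
    · rw [hij.1]; omega
    · exact hC.le i hi j hj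
  out i hi j hj w hw h h' := by
    by_cases hij : i = u ∧ j = v <;> by_cases hiw : i = u ∧ w = v
    · rw [hij.2, hiw.2]
    · rw [if_pos hij, if_neg hiw, hij.1] at h'
      exact absurd h' (by have := hout w hw; omega)
    · rw [if_neg hij, if_pos hiw, hiw.1] at h'
      exact absurd h' (by have := hout j hj; omega)
    · rw [if_neg hij] at h h'
      rw [if_neg hiw] at h'
      exact hC.out i hi j hj w hw h h'
  rev i hi j hj h := by
    by_cases hij : i = u ∧ j = v
    · obtain ⟨rfl, rfl⟩ := hij
      rw [if_neg (by tauto), if_pos ⟨rfl, rfl⟩]; omega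
    · rw [if_neg hij] at h ⊢
      split_ifs with hji
      · obtain ⟨rfl, rfl⟩ := hji
        omega
      · exact hC.rev i hi j hj h

lemma colourArcs_array {a : ℕ} (ha : a ≠ 6) : colourArcs x σ a = σ a := by
  unfold colourArcs
  refine forTo_array fun u σ => forTo_array fun v σ => ?_
  split_ifs
  · exact State.wr_array ha
  · rfl

lemma colourArcs_spec (hN : n < x.length) (hσ : Fixed x n K A R σ) (h6 : σ 6 = fun _ _ _ => 0)
    (hA : ∀ u < n, ∀ v < n, A u v ≤ 1) (hAd : ∀ u < n, A u u = 0) :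
    ArcColouring n A (fun u v => r2 x (colourArcs x σ) 6 u v) ∧
      ∀ u < n, ∀ v < n, A u v ≠ 0 → r2 x (colourArcs x σ) 6 u v ≠ 0 := by
  have hdeg : ∀ u < n, (∑ w ∈ Finset.range n, A u w) ≤ n := fun u hu => by
    have := Finset.sum_le_card_nsmul (Finset.range n) (fun w => A u w) 1
      fun w hw => hA u hu w (Finset.mem_range.1 hw)
    simpa using this
  -- Besides being proper, the colouring covers exactly the arcs that precede `(i, j)`; hence the
  -- arc to be coloured next still has colour `0`, as `exists_free_colour` requires.
  let P : ℕ → ℕ → State → Prop := fun i j σ' => (∀ a, a ≠ 6 → σ' a = σ a) ∧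
    ArcColouring n A (fun u v => r2 x σ' 6 u v) ∧
    ∀ u < n, ∀ v < n, A u v ≠ 0 → (r2 x σ' 6 u v ≠ 0 ↔ (u < i ∨ u = i ∧ v < j))
  have key : P n 0 (colourArcs x σ) := by
    unfold colourArcs
    rw [hσ.num]
    refine forTo_induct (fun i σ' => P i 0 σ') hN.le ?_ ?_
    · have h0 : ∀ u v, r2 x σ 6 u v = 0 := fun u v => by simp [State.rd, h6]
      refine ⟨fun _ _ => rfl, ⟨?_, ?_, ?_, ?_⟩, ?_⟩ <;> intros <;> simp_all
    · rintro i hi σ₁ hσ₁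
      have e1 : r0 x σ₁ 1 = n := by rw [State.rd_congr (hσ₁.1 1 (by decide)), hσ.num]
      rw [e1]
      have : P i n _ := forTo_induct (σ := σ₁) (fun j σ' => P i j σ') hN.le hσ₁
        (body := fun v σ => if 0 < r2 x σ 4 i v then
          w2 x σ 6 i v (1 + supTo x.length (degree x σ i + 1) fun c =>
            if conflicts x σ i v c = 0 then c else 0) else σ) ?_
      · refine ⟨this.1, this.2.1, fun u hu v hv huv => (this.2.2 u hu v hv huv).trans ?_⟩
        omega
      · rintro j hj σ₂ ⟨g1, g2, g3⟩
        have hF : Fixed x n K A R σ₂ := hσ.of_eq (g1 1 (by decide)) (g1 3 (by decide))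
          (g1 4 (by decide)) (g1 5 (by decide))
        rw [hF.adj]
        split_ifs with hij
        · have hne : i ≠ j := by
            rintro rfl; rw [hAd i hi] at hij; exact absurd hij (by omega)
          have hdeg' : degree x σ₂ i = ∑ w ∈ Finset.range n, A i w := by
            rw [degree, hF.num, sumTo_of_le hN.le]
            exact Finset.sum_congr rfl fun w _ => hF.adj i w
          have hconf : ∀ c, conflicts x σ₂ i j c = 0 ↔
              (∀ w < n, r2 x σ₂ 6 i w ≠ c + 1) ∧ r2 x σ₂ 6 j i ≠ c + 1 := by
            intro c
            rw [conflicts, hF.num, sumTo_of_le hN.le, Nat.add_eq_zero_iff, Finset.sum_eq_zero_iff]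
            simp
          have hd := hdeg i hi
          obtain ⟨c₀, hc₀, hf₁, hf₂⟩ := exists_free_colour hA g2 hi hj hij.ne' (by
            by_contra h
            have := (g3 i hi j hj hij.ne').1 h
            omega)
          rw [hdeg', supTo_of_le (by omega)]
          obtain ⟨s1, s2⟩ := Finset.sup_select (m := (∑ w ∈ Finset.range n, A i w) + 1)
            (fun c => conflicts x σ₂ i j c = 0) ⟨c₀, hc₀, (hconf c₀).2 ⟨hf₁, hf₂⟩⟩
          set c := (Finset.range ((∑ w ∈ Finset.range n, A i w) + 1)).sup
            fun c => if conflicts x σ₂ i j c = 0 then c else 0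
          obtain ⟨f1, f2⟩ := (hconf c).1 s1
          have hread : ∀ u < n, ∀ v < n, r2 x (w2 x σ₂ 6 i j (1 + c)) 6 u v =
              if u = i ∧ v = j then 1 + c else r2 x σ₂ 6 u v := by
            intro u hu v hv
            rw [State.rd_wr (by omega) (by omega) (by omega) (by omega) (by omega) (by omega)]
            simp
          refine ⟨fun a ha => by rw [State.wr_array ha, g1 a ha], ?_, ?_⟩
          · have := g2.update hij.ne' s2 f1 f2 hne
            refine ⟨fun u hu v hv => ?_, fun u hu v hv => ?_, fun u hu v hv w hw => ?_,
              fun u hu v hv => ?_⟩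
            · simp only [hread u hu v hv]; exact this.adj u hu v hv
            · simp only [hread u hu v hv]; exact this.le u hu v hv
            · simp only [hread u hu v hv, hread u hu w hw]; exact this.out u hu v hv w hw
            · simp only [hread u hu v hv, hread v hv u hu]; exact this.rev u hu v hv
          · intro u hu v hv huv
            rw [hread u hu v hv]
            split_ifs with h
            · simp only [ne_eq, Nat.add_eq_zero_iff, one_ne_zero, false_and, not_false_eq_true,
                true_iff]
              omega
            · rw [g3 u hu v hv huv]; omega
        · refine ⟨g1, g2, fun u hu v hv huv => ?_⟩
          rw [g3 u hu v hv huv]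
          have : ¬ (u = i ∧ v = j) := by
            rintro ⟨rfl, rfl⟩; omega
          omega
  exact ⟨key.2.1, fun u hu v hv huv => (key.2.2 u hu v hv huv).2 (Or.inl hu)⟩

/-! One colour class -/

/-- `f` maps each vertex to its successor in the colour class `c + 1`, if there is one, and to
itself otherwise. -/
structure Successor (n : ℕ) (C : ℕ → ℕ → ℕ) (c : ℕ) (f : ℕ → ℕ) : Prop where
  of_arc : ∀ v < n, ∀ w < n, C v w = c + 1 → f v = w
  of_none : ∀ v < n, (∀ w < n, C v w ≠ c + 1) → f v = v

lemma Successor.lt {c : ℕ} {f : ℕ → ℕ} (h : Successor n C c f) : ∀ v < n, f v < n := by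
  intro v hv
  by_cases hw : ∃ w < n, C v w = c + 1
  · obtain ⟨w, hw, hc⟩ := hw
    rwa [h.of_arc v hv w hw hc]
  · push Not at hw
    rwa [h.of_none v hv hw]

lemma findSuccessors_array {a c : ℕ} (ha : a ≠ 7) : findSuccessors x c σ a = σ a :=
  forTo_array fun _ _ => State.wr_array ha

lemma findSuccessors_spec (hN : n < x.length) (hσ : Fixed x n K A R σ)
    (hC : ArcColouring n A (fun u v => r2 x σ 6 u v)) (c : ℕ) :
    Successor n (fun u v => r2 x σ 6 u v) c (fun v => r1 x (findSuccessors x c σ) 7 v) := by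
  have key : ∀ v < n, r1 x (findSuccessors x c σ) 7 v =
      if (∑ w ∈ Finset.range n, if r2 x σ 6 v w = c + 1 then 1 else 0) = 0 then v
      else (Finset.range n).sup fun w => if r2 x σ 6 v w = c + 1 then w else 0 := by
    intro v hv
    unfold findSuccessors
    rw [hσ.num, forTo_fill _ hN.le ?_ v hv, hσ.num, sumTo_of_le hN.le, supTo_of_le hN.le]
    intro v _ σ' h
    simp only [State.rd_congr (h 1 (by decide)), State.rd_congr (h 6 (by decide))]
  have hsum : ∀ v, (∑ w ∈ Finset.range n, if r2 x σ 6 v w = c + 1 then 1 else 0) = 0 ↔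
      ∀ w < n, r2 x σ 6 v w ≠ c + 1 := by
    intro v
    rw [Finset.sum_eq_zero_iff]
    simp
  refine ⟨fun v hv w hw hvw => ?_, fun v hv h => ?_⟩
  · simp only [key v hv]
    rw [if_neg fun h => (hsum v).1 h w hw hvw]
    -- The maximum picks some head of an arc of this colour, and a proper colouring has only one
    -- from `v`.
    obtain ⟨h1, h2⟩ := Finset.sup_select (m := n) (fun w => r2 x σ 6 v w = c + 1) ⟨w, hw, hvw⟩
    exact hC.out v hv w hw _ h2 (by simp only [hvw]; omega) (h1.trans hvw.symm)
  · simp only [key v hv]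
    rw [if_pos ((hsum v).2 h)]

lemma findRoots_array {a : ℕ} (h8 : a ≠ 8) (h9 : a ≠ 9) : findRoots x σ a = σ a := by
  refine forTo_array fun v σ => ?_
  simp only [thn_apply]
  rw [forTo_array, State.wr_array h9, forTo_array, State.wr_array h8]
  · exact fun _ _ => State.wr_array h8
  · intro _ _
    rw [thn_apply, State.wr_array h8, State.wr_array h9]

lemma findRoots_spec (hN : n < x.length) (hσ : r0 x σ 1 = n) {f : ℕ → ℕ}
    (hf : ∀ v < n, f v < n) (hσf : ∀ v < n, r1 x σ 7 v = f v) :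
    ∀ v < n, r1 x (findRoots x σ) 9 v = cycleMax n f v := by
  unfold findRoots
  rw [hσ]
  refine (forTo_induct (fun i σ' => (∀ a, a ≠ 8 → a ≠ 9 → σ' a = σ a) ∧
    ∀ v < i, r1 x σ' 9 v = cycleMax n f v) hN.le
    ⟨fun _ _ _ => rfl, fun v hv => absurd hv (by omega)⟩ ?_).2
  rintro v hv σ₁ ⟨h1, h2⟩
  simp only [thn_apply]
  set σ₂ := w0 x σ₁ 8 v with hσ₂
  have a₂ : ∀ a, a ≠ 8 → σ₂ a = σ₁ a := fun a ha => State.wr_array ha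
  have e₂ : r0 x σ₂ 1 = n := by
    rw [State.rd_congr (a₂ 1 (by decide)), State.rd_congr (h1 1 (by decide) (by decide)), hσ]
  rw [e₂]
  -- Walking `n` steps brings the pointer in array `8` onto the cycle.
  obtain ⟨a₃, b₃⟩ := forTo_induct (N := x.length) (σ := σ₂)
    (body := fun _ σ => w0 x σ 8 (r1 x σ 7 (r0 x σ 8)))
    (fun t σ' => (∀ a, a ≠ 8 → σ' a = σ₂ a) ∧ r0 x σ' 8 = f^[t] v) hN.le
    ⟨fun _ _ => rfl, by
      rw [State.rd_wr (by omega) (by omega) (by omega) (by omega) (by omega) (by omega)]; simp⟩ (by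
      rintro t - σ' ⟨g1, g2⟩
      refine ⟨fun a ha => by rw [State.wr_array ha, g1 a ha], ?_⟩
      rw [State.rd_wr (by omega) (by omega) (by omega) (by omega) (by omega) (by omega),
        if_pos (by simp), g2, State.rd_congr (g1 7 (by decide)), State.rd_congr (a₂ 7 (by decide)),
        State.rd_congr (h1 7 (by decide) (by decide)), hσf _ (iterate_lt hf hv t),
        Function.iterate_succ_apply'])
  set σ₃ := forTo x.length n (fun _ σ => w0 x σ 8 (r1 x σ 7 (r0 x σ 8))) σ₂
  set σ₄ := w1 x σ₃ 9 v 0 with hσ₄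
  have a₄ : ∀ a, a ≠ 8 → a ≠ 9 → σ₄ a = σ a := fun a h8 h9 => by
    rw [hσ₄, State.wr_array h9, a₃ a h8, a₂ a h8, h1 a h8 h9]
  have e₄ : r0 x σ₄ 1 = n := by rw [State.rd_congr (a₄ 1 (by decide) (by decide)), hσ]
  rw [e₄]
  -- Another `n` steps go around the cycle, while array `9` collects the maximum.
  obtain ⟨a₅, b₅, c₅, d₅⟩ := forTo_induct (N := x.length) (σ := σ₄)
    (body := fun _ => thn (fun σ => w1 x σ 9 v (r1 x σ 9 v + (r0 x σ 8 - r1 x σ 9 v)))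
        (fun σ => w0 x σ 8 (r1 x σ 7 (r0 x σ 8))))
    (fun t σ' => (∀ a, a ≠ 8 → a ≠ 9 → σ' a = σ a) ∧ r0 x σ' 8 = f^[n + t] v ∧
      r1 x σ' 9 v = ((Finset.range t).sup fun s => f^[n + s] v) ∧
      ∀ u < v, r1 x σ' 9 u = cycleMax n f u) hN.le
    ⟨a₄, by rw [State.rd_wr_other (by decide), b₃, add_zero], by
      rw [State.rd_wr (by omega) (by omega) (by omega) (by omega) (by omega) (by omega)]; simp,
      fun u hu => by
        rw [State.rd_wr (by omega) (by omega) (by omega) (by omega) (by omega) (by omega),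
          if_neg (by omega), State.rd_congr (a₃ 9 (by decide)), State.rd_congr (a₂ 9 (by decide)),
          h2 u hu]⟩ (by
      rintro t - σ' ⟨g1, g2, g3, g4⟩
      simp only [thn_apply]
      refine ⟨fun a h8 h9 => by rw [State.wr_array h8, State.wr_array h9, g1 a h8 h9], ?_, ?_, ?_⟩
      · rw [State.rd_wr (by omega) (by omega) (by omega) (by omega) (by omega) (by omega),
          if_pos (by simp), State.rd_wr_other (by decide), State.rd_wr_other (by decide), g2,
          State.rd_congr (g1 7 (by decide) (by decide)), hσf _ (iterate_lt hf hv _),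
          ← add_assoc, Function.iterate_succ_apply']
      · rw [State.rd_wr_other (by decide),
          State.rd_wr (by omega) (by omega) (by omega) (by omega) (by omega) (by omega),
          if_pos (by simp), g2, g3, Finset.range_add_one, Finset.sup_insert]
        exact (by intro a b; omega : ∀ a b : ℕ, b + (a - b) = max a b) _ _
      · intro u hu
        rw [State.rd_wr_other (by decide),
          State.rd_wr (by omega) (by omega) (by omega) (by omega) (by omega) (by omega),
          if_neg (by omega), g4 u hu])
  refine ⟨a₅, fun u hu => ?_⟩
  rcases Nat.lt_succ_iff_lt_or_eq.1 hu with h | rfl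
  · exact d₅ u h
  · exact c₅

/-! The dynamic program -/

lemma fillTable_array {a : ℕ} (ha : a ≠ 10) : fillTable x σ a = σ a :=
  forTo_array fun _ _ => forTo_array fun _ _ => forTo_array fun _ _ => forTo_array fun _ _ =>
    State.wr_array ha

lemma weight_congr {σ' : State} {u y z : ℕ} (h3 : σ' 3 = σ 3) (h5 : σ' 5 = σ 5)
    (h7 : σ' 7 = σ 7) : weight x σ' u y z = weight x σ u y z := by
  simp only [weight, rel, State.rd_congr h3, State.rd_congr h5, State.rd_congr h7]

lemma message_congr {σ' : State} {u y z : ℕ} (h : ∀ a, a ≠ 10 → σ' a = σ a)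
    (h' : r1 x σ 9 u ≠ u → ∀ a < x.length, r3 x σ' 10 u y a = r3 x σ 10 u y a) :
    message x σ' u y z = message x σ u y z := by
  have hw : ∀ a, weight x σ' u a z = weight x σ u a z := fun a =>
    weight_congr (h 3 (by decide)) (h 5 (by decide)) (h 7 (by decide))
  simp only [message, State.rd_congr (h 9 (by decide)), State.rd_congr (h 3 (by decide)), hw]
  split_ifs with hr
  · rfl
  · refine Finset.sup_congr rfl fun a ha => ?_
    rw [h' hr a (lt_of_lt_of_le (Finset.mem_range.1 ha) (min_le_right _ _))]

/-- The entry of `v` reads only entries of non-root predecessors, which are farther from the root.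
With rank `2n - rootDist`, the equations of the table are thus a system for `sweeps`. -/
lemma fillTable_spec (hN : n + n < x.length) (hσ : r0 x σ 1 = n) {f : ℕ → ℕ}
    (hf : ∀ v < n, f v < n) (hσf : ∀ v < n, r1 x σ 7 v = f v)
    (hρ : ∀ v < n, r1 x σ 9 v = cycleMax n f v) :
    ∀ v < n, ∀ y < x.length, ∀ z < x.length, r3 x (fillTable x σ) 10 v y z =
      ∑ u ∈ Finset.range n, if f u = v then message x (fillTable x σ) u y z else 0 := by
  let Inv : State → Prop := fun σ' => ∀ a, a ≠ 10 → σ' a = σ a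
  let rhs : State → ℕ → ℕ → ℕ → ℕ := fun σ' v y z => sumTo x.length (r0 x σ' 1) fun u =>
    if r1 x σ' 7 u = v then message x σ' u y z else 0
  let Q : ℕ × ℕ × ℕ → State → Prop := fun k σ' => k.1 < n → k.2.1 < x.length → k.2.2 < x.length →
    r3 x σ' 10 k.1 k.2.1 k.2.2 = rhs σ' k.1 k.2.1 k.2.2
  let h : ℕ × ℕ × ℕ → ℕ := fun k => n + n - rootDist n f k.1
  have hrhs : ∀ σ', Inv σ' → ∀ v y z, rhs σ' v y z =
      ∑ u ∈ Finset.range n, if f u = v then message x σ' u y z else 0 := by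
    intro σ' hI v y z
    simp only [rhs]
    rw [State.rd_congr (hI 1 (by decide)), hσ, sumTo_of_le (by omega)]
    refine Finset.sum_congr rfl fun u hu => ?_
    rw [State.rd_congr (hI 7 (by decide)), hσf u (Finset.mem_range.1 hu)]
  have hInv : ∀ v y z, ∀ σ', Inv σ' → Inv (w3 x σ' 10 v y z (rhs σ' v y z)) :=
    fun v y z σ' hI a ha => by
    rw [State.wr_array ha, hI a ha]
  -- The right-hand sides do not depend on entries of larger rank.
  have hstable : ∀ v < n, ∀ y < x.length, ∀ z < x.length, ∀ v' < n, ∀ y' z',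
      h (v', y', z') ≤ h (v, y, z) → ∀ σ', Inv σ' →
      rhs (w3 x σ' 10 v y z (rhs σ' v y z)) v' y' z' = rhs σ' v' y' z' := by
    intro v hv y hy z hz v' hv' y' z' hle σ' hI
    rw [hrhs _ (hInv v y z σ' hI), hrhs _ hI v' y' z']
    refine Finset.sum_congr rfl fun u hu => ?_
    have hu := Finset.mem_range.1 hu
    split_ifs with huv
    · refine message_congr (fun a ha => State.wr_array ha) fun hne a ha => ?_
      rw [State.rd_congr (hI 9 (by decide)), hρ u hu] at hne
      -- The predecessor `u` of `v'` is farther from the root than `v'`, which is at least as far as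
      -- `v`. So `u ≠ v`, and the write to an entry of `v` is not seen.
      have hlt := rootDist_apply_lt hf hu hne
      have hlt' := rootDist_lt (f := f) hu
      have huv' : u ≠ v := by
        rintro rfl
        simp only [h] at hle
        rw [← huv] at hle
        omega
      -- The index `y'` is arbitrary here; even if it is clamped, the vertex index tells the cells
      -- apart.
      by_cases hyN : y' ≤ x.length
      · rw [State.rd_wr (by omega) (by omega) (by omega) (by omega) hyN (by omega),
          if_neg (by omega)]
      · simp only [State.rd, State.wr]
        rw [if_neg]
        rintro ⟨-, hh, -, -⟩
        rw [min_eq_left (by omega), min_eq_left (by omega)] at hh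
        exact huv' hh
    · rfl
  have hcov : ∀ t, Covers Inv Q h t (fun σ => forTo x.length (r0 x σ 1) (fun v σ =>
      forTo x.length x.length (fun y σ => forTo x.length x.length (fun z σ =>
        w3 x σ 10 v y z (rhs σ v y z)) σ) σ) σ)
      {k | ∃ v < n, k ∈
        {k | ∃ y < x.length, k ∈ {k | ∃ z < x.length, k ∈ ({(v, y, z)} : Set _)}}} := by
    intro t
    refine covers_for (b := fun σ => r0 x σ 1) (by omega)
      (fun σ' hI => by rw [State.rd_congr (hI 1 (by decide)), hσ]) fun v hv => ?_
    refine covers_for (b := fun _ => x.length) le_rfl (fun _ _ => rfl) fun y hy => ?_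
    refine covers_for (b := fun _ => x.length) le_rfl (fun _ _ => rfl) fun z hz => ?_
    refine covers_step (hInv v y z) ?_ ?_ ?_
    · intro σ' hI _ _ _
      simp only
      rw [hstable v hv y hy z hz v hv y z le_rfl σ' hI,
        State.rd_wr (by omega) (by omega) (by omega) (by omega) (by omega) (by omega),
        if_pos ⟨rfl, rfl, rfl⟩]
    · rintro σ' ⟨v', y', z'⟩ hI hle hne hQ hv' hy' hz'
      simp only at hv' hy' hz' ⊢
      rw [hstable v hv y hy z hz v' hv' y' z' hle σ' hI,
        State.rd_wr (by omega) (by omega) (by omega) (by omega) (by omega) (by omega),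
        if_neg (by rintro ⟨rfl, rfl, rfl⟩; exact hne rfl)]
      exact hQ hv' hy' hz'
    · intro σ' hI hQ
      rw [← hQ hv hy hz]
      exact State.wr_rd
  obtain ⟨hI, hQ⟩ := sweeps (N := x.length) hcov (by
    rintro ⟨v, y, z⟩ hk σ' - hv hy hz
    exact absurd ⟨v, hv, y, hy, z, hz, rfl⟩ hk) (fun k => by simp only [h]; omega)
    (σ := σ) (fun _ _ => rfl)
  intro v hv y hy z hz
  have := hQ (v, y, z) hv hy hz
  rw [hrhs _ hI] at this
  exact this

lemma traceBack_array {a : ℕ} (ha : a ≠ 11) : traceBack x σ a = σ a :=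
  forTo_array fun _ _ => forTo_array fun _ _ => State.wr_array ha

lemma gain_congr {σ' : State} {v y : ℕ} (h : ∀ a, a ≠ 11 → σ' a = σ a)
    (h' : r1 x σ 9 v ≠ v → r1 x σ' 11 (r1 x σ 9 v) = r1 x σ 11 (r1 x σ 9 v) ∧
      r1 x σ' 11 (r1 x σ 7 v) = r1 x σ 11 (r1 x σ 7 v)) :
    gain x σ' v y = gain x σ v y := by
  have hw : ∀ a b, weight x σ' v a b = weight x σ v a b := fun a b =>
    weight_congr (h 3 (by decide)) (h 5 (by decide)) (h 7 (by decide))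
  simp only [gain, State.rd_congr (h 9 (by decide)), State.rd_congr (h 7 (by decide)),
    State.rd_congr (h 10 (by decide)), hw]
  split_ifs with hr
  · rfl
  · rw [(h' hr).1, (h' hr).2]

/-- The choice for a non-root depends on the values of its root and its successor, both nearer to
the root; so the rank is now `rootDist` itself, and information flows away from the roots. -/
lemma traceBack_spec (hN : n + n < x.length) (hσ : r0 x σ 1 = n) {f : ℕ → ℕ}
    (hf : ∀ v < n, f v < n) (hσf : ∀ v < n, r1 x σ 7 v = f v)
    (hρ : ∀ v < n, r1 x σ 9 v = cycleMax n f v)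
    (hK : ∀ v < n, 0 < r1 x σ 3 v ∧ r1 x σ 3 v ≤ x.length) :
    ∀ v < n, r1 x (traceBack x σ) 11 v < r1 x σ 3 v ∧ ∀ y < r1 x σ 3 v,
      gain x (traceBack x σ) v y ≤ gain x (traceBack x σ) v (r1 x (traceBack x σ) 11 v) := by
  let Inv : State → Prop := fun σ' => ∀ a, a ≠ 11 → σ' a = σ a
  let rhs : State → ℕ → ℕ := fun σ' v => supTo x.length (r1 x σ' 3 v) fun y =>
    if gain x σ' v y = supTo x.length (r1 x σ' 3 v) (fun y' => gain x σ' v y') then y else 0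
  let Q : ℕ → State → Prop := fun v σ' => v < n → r1 x σ' 11 v = rhs σ' v
  let h : ℕ → ℕ := fun v => if v < n then rootDist n f v else 0
  have hInv : ∀ v, ∀ σ', Inv σ' → Inv (w1 x σ' 11 v (rhs σ' v)) := fun v σ' hI a ha => by
    rw [State.wr_array ha, hI a ha]
  have hstable : ∀ v < n, ∀ v' < n, h v' ≤ h v → ∀ σ', Inv σ' →
      rhs (w1 x σ' 11 v (rhs σ' v)) v' = rhs σ' v' := by
    intro v hv v' hv' hle σ' hI
    have hgain : ∀ y, gain x (w1 x σ' 11 v (rhs σ' v)) v' y = gain x σ' v' y := by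
      intro y
      refine gain_congr (fun a ha => State.wr_array ha) fun hne => ?_
      rw [State.rd_congr (hI 9 (by decide)), hρ v' hv'] at hne ⊢
      rw [State.rd_congr (hI 7 (by decide)), hσf v' hv']
      simp only [h, if_pos hv, if_pos hv'] at hle
      have d1 := rootDist_apply_lt hf hv' hne
      have d2 := rootDist_cycleMax_lt hf hv' hne
      have l1 := hf v' hv'
      have l2 := cycleMax_lt hf hv'
      have n1 : f v' ≠ v := by rintro rfl; omega
      have n2 : cycleMax n f v' ≠ v := by intro h; rw [h] at d2; omega
      rw [State.rd_wr (by omega) (by omega) (by omega) (by omega) (by omega) (by omega),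
        State.rd_wr (by omega) (by omega) (by omega) (by omega) (by omega) (by omega),
        if_neg (fun h => n2 h.1), if_neg (fun h => n1 h.1)]
      exact ⟨rfl, rfl⟩
    simp only [rhs] at hgain ⊢
    simp only [hgain, State.rd_wr_other (show (3 : ℕ) ≠ 11 by decide)]
  have hcov : ∀ t, Covers Inv Q h t (fun σ => forTo x.length (r0 x σ 1) (fun v σ =>
      w1 x σ 11 v (rhs σ v)) σ) {k | ∃ v < n, k ∈ ({v} : Set ℕ)} := by
    intro t
    refine covers_for (b := fun σ => r0 x σ 1) (by omega)
      (fun σ' hI => by rw [State.rd_congr (hI 1 (by decide)), hσ]) fun v hv => ?_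
    refine covers_step (hInv v) ?_ ?_ ?_
    · intro σ' hI _
      rw [hstable v hv v hv le_rfl σ' hI,
        State.rd_wr (by omega) (by omega) (by omega) (by omega) (by omega) (by omega),
        if_pos ⟨rfl, rfl, rfl⟩]
    · rintro σ' v' hI hle hne hQ hv'
      rw [hstable v hv v' hv' hle σ' hI,
        State.rd_wr (by omega) (by omega) (by omega) (by omega) (by omega) (by omega),
        if_neg (fun h => hne h.1)]
      exact hQ hv'
    · intro σ' hI hQ
      rw [← hQ hv]
      exact State.wr_rd
  obtain ⟨hI, hQ⟩ := sweeps (N := x.length) hcov (by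
    rintro v hk σ' - hv
    exact absurd ⟨v, hv, rfl⟩ hk) (fun v => by
      simp only [h]
      split_ifs with hv
      · exact (rootDist_lt hv).trans hN
      · omega)
    (σ := σ) (fun _ _ => rfl)
  intro v hv
  have key := hQ v hv
  change r1 x (traceBack x σ) 11 v = _ at key
  have e3 : r1 x (traceBack x σ) 3 v = r1 x σ 3 v :=
    State.rd_congr (traceBack_array (by decide)) _ _ _
  change r1 x (traceBack x σ) 11 v = supTo x.length (r1 x (traceBack x σ) 3 v) fun y =>
    if gain x (traceBack x σ) v y =
      supTo x.length (r1 x (traceBack x σ) 3 v) (fun y' => gain x (traceBack x σ) v y')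
    then y else 0 at key
  rw [e3, supTo_of_le (hK v hv).2, supTo_of_le (hK v hv).2] at key
  obtain ⟨h1, h2⟩ := Finset.sup_select (m := r1 x σ 3 v) (fun y => gain x (traceBack x σ) v y =
    (Finset.range (r1 x σ 3 v)).sup (fun y' => gain x (traceBack x σ) v y'))
    (Finset.exists_eq_sup_range (hK v hv).1 _)
  rw [← key] at h1 h2
  refine ⟨h2, fun y hy => ?_⟩
  rw [h1]
  exact Finset.le_sup (f := fun y' => gain x (traceBack x σ) v y') (Finset.mem_range.2 hy)

end RAM

namespace RAM

/-! ### The value of an assignment and of its restrictions to colour classes -/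

/-- The number of arcs whose constraint is satisfied. -/
def arcValue (n : ℕ) (A : ℕ → ℕ → ℕ) (R : ℕ → ℕ → ℕ → ℕ → ℕ) (φ : ℕ → ℕ) : ℕ :=
  ∑ u ∈ Finset.range n, ∑ v ∈ Finset.range n, if 0 < A u v then R u v (φ u) (φ v) else 0

/-- The number of arcs of colour `c + 1` whose constraint is satisfied. -/
def classValue (n : ℕ) (C : ℕ → ℕ → ℕ) (R : ℕ → ℕ → ℕ → ℕ → ℕ) (c : ℕ) (φ : ℕ → ℕ) : ℕ :=
  ∑ u ∈ Finset.range n, ∑ v ∈ Finset.range n, if C u v = c + 1 then R u v (φ u) (φ v) else 0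

section

variable {n : ℕ} {K φ f : ℕ → ℕ} {A C : ℕ → ℕ → ℕ} {R : ℕ → ℕ → ℕ → ℕ → ℕ} {c : ℕ}

/-- Fixed points of `f` are exactly the vertices without an arc of this colour, since no arc is a
loop; they get weight `0`. -/
lemma arcWeight_eq_classValue (hC : ArcColouring n A C) (hf : Successor n C c f)
    (hAd : ∀ u < n, A u u = 0) :
    arcWeight n f (fun u y z => if f u = u then 0 else R u (f u) y z) φ = classValue n C R c φ := by
  refine Finset.sum_congr rfl fun u hu => ?_
  beta_reduce
  have hu := Finset.mem_range.1 hu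
  by_cases hw : ∃ w < n, C u w = c + 1
  · obtain ⟨w, hw, hcw⟩ := hw
    have hwu : w ≠ u := by
      rintro rfl
      exact hC.adj w hw w hw (by omega) (hAd w hw)
    rw [hf.of_arc u hu w hw hcw, if_neg hwu, Finset.sum_eq_single w, if_pos hcw]
    · intro v hv hvw
      refine if_neg fun h => hvw ?_
      exact hC.out u hu w hw v (Finset.mem_range.1 hv) (by omega) (by omega)
    · exact fun h => absurd (Finset.mem_range.2 hw) h
  · push Not at hw
    rw [hf.of_none u hu hw, if_pos rfl, Finset.sum_eq_zero]
    exact fun v hv => if_neg (hw v (Finset.mem_range.1 hv))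

/-- Opposite arcs have different colours, so the arcs of the class and their reverses are disjoint,
and an arc is satisfied iff its reverse is. -/
lemma two_mul_classValue_le (hC : ArcColouring n A C)
    (hA : ∀ u < n, ∀ v < n, A u v = A v u)
    (hR : ∀ u < n, ∀ v < n, 0 < A u v → R u v (φ u) (φ v) = R v u (φ v) (φ u)) :
    2 * classValue n C R c φ ≤ arcValue n A R φ := by
  have hswap : classValue n C R c φ = ∑ u ∈ Finset.range n, ∑ v ∈ Finset.range n,
      if C v u = c + 1 then R v u (φ v) (φ u) else 0 := Finset.sum_comm
  rw [two_mul]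
  nth_rewrite 2 [hswap]
  rw [classValue, ← Finset.sum_add_distrib]
  refine Finset.sum_le_sum fun u hu => ?_
  rw [← Finset.sum_add_distrib]
  refine Finset.sum_le_sum fun v hv => ?_
  have hu := Finset.mem_range.1 hu
  have hv := Finset.mem_range.1 hv
  by_cases h1 : C u v = c + 1
  · have hrev := hC.rev u hu v hv (by omega)
    have hadj := hC.adj u hu v hv (by omega)
    rw [if_pos h1, if_neg (by omega), if_pos (by omega), add_zero]
  · rw [if_neg h1, zero_add]
    split_ifs with h2 h3
    · exact (hR u hu v hv h3).ge
    · have hadj := hC.adj v hv u hu (by omega)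
      rw [hA v hv u hu] at hadj
      omega
    · exact Nat.zero_le _
    · exact le_rfl

lemma sum_classValue {m : ℕ} (hC : ArcColouring n A C)
    (hpos : ∀ u < n, ∀ v < n, A u v ≠ 0 → C u v ≠ 0) (hm : ∀ u < n, ∀ v < n, C u v ≤ m) :
    ∑ c ∈ Finset.range m, classValue n C R c φ = arcValue n A R φ := by
  unfold classValue arcValue
  rw [Finset.sum_comm]
  refine Finset.sum_congr rfl fun u hu => ?_
  rw [Finset.sum_comm]
  refine Finset.sum_congr rfl fun v hv => ?_
  have hu := Finset.mem_range.1 hu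
  have hv := Finset.mem_range.1 hv
  by_cases h : C u v = 0
  · rw [if_neg (by have := mt (hpos u hu v hv) (by simpa using h); omega), Finset.sum_eq_zero]
    exact fun c _ => if_neg (by omega)
  · have hadj := hC.adj u hu v hv h
    have hle := hm u hu v hv
    -- The arc is counted in its own class only, the one with index `C u v - 1`.
    rw [if_pos (by omega), Finset.sum_eq_single (C u v - 1), if_pos (by omega)]
    · exact fun c _ hc => if_neg (by omega)
    · exact fun hc => absurd (Finset.mem_range.2 (by omega)) hc

end

variable {x : List Bool} {n : ℕ} {K : ℕ → ℕ} {A C : ℕ → ℕ → ℕ} {R : ℕ → ℕ → ℕ → ℕ → ℕ} {σ : State}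

lemma readSizes_array {a : ℕ} (h1 : a ≠ 1) (h2 : a ≠ 2) (h3 : a ≠ 3) :
    readSizes x σ a = σ a := by
  simp only [readSizes, thn_apply]
  rw [forTo_array, State.wr_array h2, State.wr_array h1]
  intro _ _
  rw [thn_apply, State.wr_array h2, State.wr_array h3]

lemma readPairs_array {a : ℕ} (h2 : a ≠ 2) (h4 : a ≠ 4) (h5 : a ≠ 5) :
    readPairs x σ a = σ a := by
  refine forTo_array fun u σ => forTo_array fun v σ => ?_
  split_ifs
  · simp only [readPair, thn_apply]
    rw [State.wr_array h2, State.wr_array h5, State.wr_array h5, State.wr_array h4,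
      State.wr_array h4]
  · rfl

/-- The stored assignment is at least as good as the stored value. -/
structure BestStored (x : List Bool) (n : ℕ) (K : ℕ → ℕ) (A : ℕ → ℕ → ℕ)
    (R : ℕ → ℕ → ℕ → ℕ → ℕ) (σ : State) : Prop where
  lt : ∀ v < n, σ.rd x.length 0 0 0 (v + 1) < K v
  le : r0 x σ 12 ≤ arcValue n A R fun v => σ.rd x.length 0 0 0 (v + 1)

lemma keepBest_array {a : ℕ} (h0 : a ≠ 0) (h12 : a ≠ 12) (h13 : a ≠ 13) :
    keepBest x σ a = σ a := by
  simp only [keepBest, thn_apply]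
  split_ifs
  · rw [State.wr_array h12, forTo_array fun _ _ => State.wr_array h0, State.wr_array h13]
  · rw [State.wr_array h13]

lemma arcValue_congr {φ φ' : ℕ → ℕ} (h : ∀ v < n, φ v = φ' v) :
    arcValue n A R φ = arcValue n A R φ' :=
  Finset.sum_congr rfl fun u hu => Finset.sum_congr rfl fun v hv => by
    rw [h u (Finset.mem_range.1 hu), h v (Finset.mem_range.1 hv)]

lemma keepBest_spec (hN : n < x.length) (hσ : Fixed x n K A R σ) (hb : BestStored x n K A R σ)
    (hψ : ∀ v < n, r1 x σ 11 v < K v) :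
    BestStored x n K A R (keepBest x σ) ∧ r0 x σ 12 ≤ r0 x (keepBest x σ) 12 ∧
      arcValue n A R (fun v => r1 x σ 11 v) ≤ r0 x (keepBest x σ) 12 := by
  have hval : (sumTo x.length (r0 x σ 1) fun u => sumTo x.length (r0 x σ 1) fun v =>
      if 0 < r2 x σ 4 u v then rel x σ u v (r1 x σ 11 u) (r1 x σ 11 v) else 0) =
      arcValue n A R (fun v => r1 x σ 11 v) := by
    rw [hσ.num, sumTo_of_le hN.le]
    refine Finset.sum_congr rfl fun u _ => ?_
    rw [sumTo_of_le hN.le]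
    exact Finset.sum_congr rfl fun v _ => by rw [hσ.adj, hσ.rel]
  simp only [keepBest, thn_apply]
  rw [hval]
  set y := arcValue n A R (fun v => r1 x σ 11 v) with hy
  set σ₁ := w0 x σ 13 y with hσ₁
  have a₁ : ∀ a, a ≠ 13 → σ₁ a = σ a := fun a ha => State.wr_array ha
  have e₁ : r0 x σ₁ 13 = y := by
    rw [State.rd_wr (by omega) (by omega) (by omega) (by omega) (by omega) (by omega)]; simp
  have e₂ : r0 x σ₁ 12 = r0 x σ 12 := State.rd_congr (a₁ 12 (by decide)) _ _ _
  have e₃ : r0 x σ₁ 1 = n := by rw [State.rd_congr (a₁ 1 (by decide)), hσ.num]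
  have e₄ : ∀ k, σ₁.rd x.length 0 0 0 k = σ.rd x.length 0 0 0 k :=
    fun k => State.rd_congr (a₁ 0 (by decide)) _ _ _
  rw [e₁, e₂, e₃]
  split_ifs with hlt
  · obtain ⟨a₂, b₂⟩ := forTo_induct (N := x.length) (σ := σ₁)
      (body := fun v σ => σ.wr x.length 0 0 0 (v + 1) (r1 x σ 11 v))
      (fun i σ' => (∀ a, a ≠ 0 → σ' a = σ₁ a) ∧
        ∀ v < i, σ'.rd x.length 0 0 0 (v + 1) = r1 x σ 11 v) hN.le
      ⟨fun _ _ => rfl, fun v hv => absurd hv (by omega)⟩ (by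
        rintro i hi σ' ⟨g1, g2⟩
        refine ⟨fun a ha => by rw [State.wr_array ha, g1 a ha], fun v hv => ?_⟩
        rw [State.rd_wr (by omega) (by omega) (by omega) (by omega) (by omega) (by omega)]
        split_ifs with h
        · obtain rfl : v = i := by omega
          rw [State.rd_congr (g1 11 (by decide)), State.rd_congr (a₁ 11 (by decide))]
        · exact g2 v (by omega))
    set σ₂ := forTo x.length n (fun v σ => σ.wr x.length 0 0 0 (v + 1) (r1 x σ 11 v)) σ₁
    have e₅ : r0 x σ₂ 13 = y := by rw [State.rd_congr (a₂ 13 (by decide)), e₁]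
    have e₆ : r0 x (w0 x σ₂ 12 (r0 x σ₂ 13)) 12 = y := by
      rw [State.rd_wr (by omega) (by omega) (by omega) (by omega) (by omega) (by omega), e₅]; simp
    have e₇ : ∀ v < n, (w0 x σ₂ 12 (r0 x σ₂ 13)).rd x.length 0 0 0 (v + 1) = r1 x σ 11 v :=
      fun v hv => by rw [State.rd_wr_other (by decide), b₂ v hv]
    refine ⟨⟨fun v hv => by rw [e₇ v hv]; exact hψ v hv, ?_⟩, ?_, ?_⟩
    · rw [e₆, arcValue_congr e₇]
    · rw [e₆]; exact hlt.le
    · rw [e₆]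
  -- Without an improvement the stored assignment stays and its value dominates the new one.
  · refine ⟨⟨fun v hv => by rw [e₄]; exact hb.lt v hv, ?_⟩, by rw [e₂], by rw [e₂]; omega⟩
    rw [e₂]
    simp only [e₄]
    exact hb.le

lemma treatColour_array {a c : ℕ} (h : a < 7) (h0 : a ≠ 0) : treatColour x c σ a = σ a := by
  simp only [treatColour, thn_apply]
  rw [keepBest_array h0 (by omega) (by omega), traceBack_array (by omega),
    fillTable_array (by omega), findRoots_array (by omega) (by omega),
    findSuccessors_array (by omega)]

/-- The assignment found is optimal on the class, and its value on the whole instance is at least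
twice its value on the class. -/
lemma treatColour_spec (hN : n + n < x.length) (hσ : Fixed x n K A R σ)
    (hC : ArcColouring n A (fun u v => r2 x σ 6 u v)) (hb : BestStored x n K A R σ)
    (hK : ∀ v < n, 0 < K v ∧ K v ≤ x.length) (hAd : ∀ u < n, A u u = 0)
    (hA : ∀ u < n, ∀ v < n, A u v = A v u)
    (hR : ∀ u < n, ∀ v < n, 0 < A u v → ∀ a < K u, ∀ b < K v, R u v a b = R v u b a) (c : ℕ) :
    BestStored x n K A R (treatColour x c σ) ∧ r0 x σ 12 ≤ r0 x (treatColour x c σ) 12 ∧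
      ∀ φ : ℕ → ℕ, (∀ v < n, φ v < K v) →
        2 * classValue n (fun u v => r2 x σ 6 u v) R c φ ≤ r0 x (treatColour x c σ) 12 := by
  simp only [treatColour, thn_apply]
  have hS := findSuccessors_spec (by omega) hσ hC c
  set σ₁ := findSuccessors x c σ with hσ₁
  have a₁ : ∀ a, a ≠ 7 → σ₁ a = σ a := fun a ha => findSuccessors_array ha
  set f : ℕ → ℕ := fun v => r1 x σ₁ 7 v with hf
  have hfl := hS.lt
  have n₁ : r0 x σ₁ 1 = n := by rw [State.rd_congr (a₁ 1 (by decide)), hσ.num]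
  have hρ₂ := findRoots_spec (by omega) n₁ hfl fun _ _ => rfl
  set σ₂ := findRoots x σ₁ with hσ₂
  have a₂ : ∀ a, a ≠ 7 → a ≠ 8 → a ≠ 9 → σ₂ a = σ a := fun a h7 h8 h9 => by
    rw [hσ₂, findRoots_array h8 h9, a₁ a h7]
  have f₂ : ∀ v < n, r1 x σ₂ 7 v = f v := fun v _ =>
    State.rd_congr (findRoots_array (by decide) (by decide)) _ _ _
  have n₂ : r0 x σ₂ 1 = n := by
    rw [State.rd_congr (a₂ 1 (by decide) (by decide) (by decide)), hσ.num]
  have hB₃ := fillTable_spec hN n₂ hfl f₂ hρ₂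
  set σ₃ := fillTable x σ₂ with hσ₃
  have b₃ : ∀ a, a ≠ 10 → σ₃ a = σ₂ a := fun a ha => fillTable_array ha
  have F₃ : Fixed x n K A R σ₃ := by
    refine hσ.of_eq ?_ ?_ ?_ ?_ <;>
      rw [b₃ _ (by decide), a₂ _ (by decide) (by decide) (by decide)]
  have f₃ : ∀ v < n, r1 x σ₃ 7 v = f v := fun v hv => by
    rw [State.rd_congr (b₃ 7 (by decide)), f₂ v hv]
  have ρ₃ : ∀ v < n, r1 x σ₃ 9 v = cycleMax n f v := fun v hv => by
    rw [State.rd_congr (b₃ 9 (by decide)), hρ₂ v hv]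
  have hT₄ := traceBack_spec hN F₃.num hfl f₃ ρ₃ (fun v hv => by rw [F₃.size]; exact hK v hv)
  set σ₄ := traceBack x σ₃ with hσ₄
  have b₄ : ∀ a, a ≠ 11 → σ₄ a = σ₃ a := fun a ha => traceBack_array ha
  have F₄ : Fixed x n K A R σ₄ := by
    refine F₃.of_eq ?_ ?_ ?_ ?_ <;> exact b₄ _ (by decide)
  have keep : ∀ a, a = 0 ∨ a = 12 → σ₄ a = σ a := by
    intro a ha
    rw [b₄ a (by omega), b₃ a (by omega), a₂ a (by omega) (by omega) (by omega)]
  have hb₄ : BestStored x n K A R σ₄ := by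
    refine ⟨fun v hv => ?_, ?_⟩
    · rw [State.rd_congr (keep 0 (Or.inl rfl))]; exact hb.lt v hv
    · simp only [State.rd_congr (keep 0 (Or.inl rfl)), State.rd_congr (keep 12 (Or.inr rfl))]
      exact hb.le
  set ψ : ℕ → ℕ := fun v => r1 x σ₄ 11 v with hψ
  have hψK : ∀ v < n, ψ v < K v := fun v hv => by
    have := (hT₄ v hv).1
    rwa [F₃.size] at this
  obtain ⟨g1, g2, g3⟩ := keepBest_spec (by omega) F₄ hb₄ hψK
  refine ⟨g1, by rwa [State.rd_congr (keep 12 (Or.inr rfl))] at g2, fun φ hφ => ?_⟩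
  set w : ℕ → ℕ → ℕ → ℕ := fun u y z => if f u = u then 0 else R u (f u) y z with hw
  have w₃ : ∀ u < n, ∀ y z, weight x σ₃ u y z = w u y z := fun u hu y z => by
    rw [weight, f₃ u hu, F₃.rel]
  have w₄ : ∀ u < n, ∀ y z, weight x σ₄ u y z = w u y z := fun u hu y z => by
    rw [weight_congr (b₄ 3 (by decide)) (b₄ 5 (by decide)) (b₄ 7 (by decide)), w₃ u hu]
  have hρl : ∀ v < n, cycleMax n f v < n := fun v hv => cycleMax_lt hfl hv
  have gain₄ : ∀ v < n, ∀ y, gain x σ₄ v y =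
      if cycleMax n f v = v then r3 x σ₃ 10 v y y
      else r3 x σ₃ 10 v (ψ (cycleMax n f v)) y + w v y (ψ (f v)) := fun v hv y => by
    rw [gain, State.rd_congr (b₄ 9 (by decide)), ρ₃ v hv, State.rd_congr (b₄ 7 (by decide)),
      f₃ v hv, State.rd_congr (b₄ 10 (by decide)), State.rd_congr (b₄ 10 (by decide)), w₄ v hv]
  have hopt : arcWeight n f w φ ≤ arcWeight n f w ψ := by
    refine arcWeight_le_of_table (ρ := cycleMax n f) (K := K) (B := fun v y z => r3 x σ₃ 10 v y z)
      hfl hρl (fun v hv => cycleMax_apply hfl hv) ?_ ψ hψK ?_ ?_ φ hφ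
    · intro v hv y hy z hz
      have k1 := hK _ (hρl v hv)
      have k2 := hK v hv
      rw [hB₃ v hv y (by omega) z (by omega)]
      refine Finset.sum_congr rfl fun u hu => ?_
      have hu := Finset.mem_range.1 hu
      rw [message, ρ₃ u hu, F₃.size, w₃ u hu, supTo_of_le (hK u hu).2]
      simp only [w₃ u hu]
    · intro v hv hroot y hy
      have := (hT₄ v hv).2 y (by rw [F₃.size]; exact hy)
      rwa [gain₄ v hv, gain₄ v hv, if_pos hroot, if_pos hroot] at this
    · intro v hv hroot y hy
      have := (hT₄ v hv).2 y (by rw [F₃.size]; exact hy)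
      rwa [gain₄ v hv, gain₄ v hv, if_neg hroot, if_neg hroot] at this
  rw [arcWeight_eq_classValue hC hS hAd, arcWeight_eq_classValue hC hS hAd] at hopt
  calc 2 * classValue n (fun u v => r2 x σ 6 u v) R c φ
      ≤ 2 * classValue n (fun u v => r2 x σ 6 u v) R c ψ := Nat.mul_le_mul_left 2 hopt
    _ ≤ arcValue n A R ψ := two_mul_classValue_le hC hA fun u hu v hv h =>
        hR u hu v hv h _ (hψK u hu) _ (hψK v hv)
    _ ≤ _ := g3

/-- The loop over all colours finds a good assignment. -/
lemma treatColours_spec (hN : n + n < x.length) (hσ : Fixed x n K A R σ)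
    (hC : ArcColouring n A (fun u v => r2 x σ 6 u v))
    (hpos : ∀ u < n, ∀ v < n, A u v ≠ 0 → r2 x σ 6 u v ≠ 0) (hb : BestStored x n K A R σ)
    (hK : ∀ v < n, 0 < K v ∧ K v ≤ x.length) (hAd : ∀ u < n, A u u = 0)
    (hA₁ : ∀ u < n, ∀ v < n, A u v ≤ 1) (hA : ∀ u < n, ∀ v < n, A u v = A v u)
    (hR : ∀ u < n, ∀ v < n, 0 < A u v → ∀ a < K u, ∀ b < K v, R u v a b = R v u b a) {d : ℕ}
    (hd : ∀ u < n, ∑ w ∈ Finset.range n, A u w ≤ d) {σ' : State}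
    (hσ' : σ' = forTo x.length n (treatColour x) σ) :
    (∀ v < n, σ'.rd x.length 0 0 0 (v + 1) < K v) ∧ σ' 1 = σ 1 ∧
      ∀ φ : ℕ → ℕ, (∀ v < n, φ v < K v) →
        2 * arcValue n A R φ ≤
          (d + 1) * arcValue n A R fun v => σ'.rd x.length 0 0 0 (v + 1) := by
  have key := forTo_induct (N := x.length) (σ := σ) (b := n) (body := treatColour x)
    (fun i σ' => (∀ a, a < 7 → a ≠ 0 → σ' a = σ a) ∧ BestStored x n K A R σ' ∧
      ∀ c < i, ∀ φ : ℕ → ℕ, (∀ v < n, φ v < K v) →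
        2 * classValue n (fun u v => r2 x σ 6 u v) R c φ ≤ r0 x σ' 12) (by omega)
    ⟨fun _ _ _ => rfl, hb, fun c hc => absurd hc (by omega)⟩ (by
      rintro c hc σ₁ ⟨h1, h2, h3⟩
      have F₁ : Fixed x n K A R σ₁ := by
        refine hσ.of_eq ?_ ?_ ?_ ?_ <;> exact h1 _ (by decide) (by decide)
      have e6 : (fun u v => r2 x σ₁ 6 u v) = fun u v => r2 x σ 6 u v := by
        funext u v; exact State.rd_congr (h1 6 (by decide) (by decide)) _ _ _
      obtain ⟨g1, g2, g3⟩ := treatColour_spec hN F₁ (e6 ▸ hC) h2 hK hAd hA hR c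
      refine ⟨fun a ha h0 => by rw [treatColour_array ha h0, h1 a ha h0], g1, fun c' hc' φ hφ => ?_⟩
      rcases Nat.lt_succ_iff_lt_or_eq.1 hc' with h | rfl
      · exact (h3 c' h φ hφ).trans g2
      · have := g3 φ hφ
        rwa [e6] at this)
  rw [← hσ'] at key
  obtain ⟨h1, h2, h3⟩ := key
  refine ⟨h2.lt, h1 1 (by decide) (by decide), fun φ hφ => ?_⟩
  -- The loop runs over `n` colours because `d` is unknown to the algorithm. This is enough: the
  -- diagonal entry of the adjacency matrix is `0`, so degrees are below `n` and colours at most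
  -- `n`.
  have hmax : ∀ u < n, ∀ v < n, r2 x σ 6 u v ≤ min n (d + 1) := by
    intro u hu v hv
    have hle := hC.le u hu v hv
    have hdu := hd u hu
    have hlt : ∑ w ∈ Finset.range n, A u w < n := by
      calc ∑ w ∈ Finset.range n, A u w < ∑ w ∈ Finset.range n, 1 :=
            Finset.sum_lt_sum (fun w hw => hA₁ u hu w (Finset.mem_range.1 hw))
              ⟨u, Finset.mem_range.2 hu, by rw [hAd u hu]; exact Nat.one_pos⟩
        _ = n := by simp
    omega
  rw [← sum_classValue hC hpos hmax, Finset.mul_sum]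
  calc ∑ c ∈ Finset.range (min n (d + 1)), 2 * classValue n (fun u v => r2 x σ 6 u v) R c φ
      ≤ ∑ c ∈ Finset.range (min n (d + 1)), r0 x σ' 12 :=
        Finset.sum_le_sum fun c hc => h3 c (by have := Finset.mem_range.1 hc; omega) φ hφ
    _ = min n (d + 1) * r0 x σ' 12 := by simp
    _ ≤ _ := Nat.mul_le_mul (min_le_right _ _) h2.le

end RAM

/-! ### From arcs back to edges of the instance -/

namespace TwoCSP

variable {n : ℕ} {k : Fin n → ℕ} (I : TwoCSP (Fin n) (fun v => Fin (k v)))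

/-- The graph of the satisfied edges. -/
def satisfiedGraph (ψ : ∀ v, Fin (k v)) : SimpleGraph (Fin n) where
  Adj u v := ∃ h : I.graph.Adj u v, (ψ u, ψ v) ∈ I.rel h
  symm := ⟨fun _ _ ⟨h, h'⟩ => ⟨h.symm, (I.rel_symm h _ _).1 h'⟩⟩
  loopless := ⟨fun v ⟨h, _⟩ => I.graph.loopless.irrefl v h⟩

lemma satisfied_eq (ψ : ∀ v, Fin (k v)) : I.satisfied ψ = (I.satisfiedGraph ψ).edgeSet := by
  ext e
  induction e with
  | _ u v =>
    rw [SimpleGraph.mem_edgeSet]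
    constructor
    · rintro ⟨a, b, h, hab, hr⟩
      have : (I.satisfiedGraph ψ).Adj a b := ⟨h, hr⟩
      rw [← SimpleGraph.mem_edgeSet, ← hab] at this
      exact this
    · rintro ⟨h, hr⟩
      exact ⟨u, v, h, rfl, hr⟩

open Classical in
lemma two_mul_ncard_satisfied (ψ : ∀ v, Fin (k v)) : 2 * (I.satisfied ψ).ncard =
    ∑ u : Fin n, ∑ v : Fin n, if (I.satisfiedGraph ψ).Adj u v then 1 else 0 := by
  rw [satisfied_eq, ← SimpleGraph.coe_edgeFinset, Set.ncard_coe_finset,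
    ← SimpleGraph.sum_degrees_eq_twice_card_edges]
  refine Finset.sum_congr rfl fun u _ => ?_
  rw [← SimpleGraph.card_neighborFinset_eq_degree, SimpleGraph.neighborFinset_eq_filter,
    Finset.card_filter]

/-- Each satisfied edge is counted in both orientations, as in the handshake lemma. -/
lemma two_mul_ncard_eq_arcValue {σ : RAM.State} (h : RAM.Describes I σ) (ψ : ∀ v, Fin (k v))
    (φ : ℕ → ℕ) (hφ : ∀ v : Fin n, φ v = ψ v) : 2 * (I.satisfied ψ).ncard =
    RAM.arcValue n (fun u v => r2 I.encode σ 4 u v) (RAM.rel I.encode σ) φ := by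
  classical
  rw [two_mul_ncard_satisfied, RAM.arcValue, Finset.sum_range]
  refine Finset.sum_congr rfl fun u _ => ?_
  rw [Finset.sum_range]
  refine Finset.sum_congr rfl fun v _ => ?_
  rw [h.adj, hφ, hφ]
  by_cases hadj : I.graph.Adj u v
  · rw [if_pos hadj, if_pos Nat.one_pos, h.rel u v hadj]
    exact if_congr ⟨fun ⟨_, h⟩ => h, fun h => ⟨hadj, h⟩⟩ rfl rfl
  · rw [if_neg hadj, if_neg (lt_irrefl 0)]
    exact if_neg fun ⟨h, _⟩ => hadj h

lemma algorithm_spec (hk : ∀ v, 0 < k v) {d : ℕ} (hd : I.IsBoundedDegree d) :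
    ∃ ψ : ∀ v, Fin (k v),
      RAM.algorithm I.encode (fun _ _ _ _ => 0) 0 0 0 0 = n ∧
      (∀ v : Fin n, RAM.algorithm I.encode (fun _ _ _ _ => 0) 0 0 0 (v + 1) = ψ v) ∧
      ∀ ψ' : ∀ v, Fin (k v), 2 * (I.satisfied ψ').ncard ≤ (d + 1) * (I.satisfied ψ).ncard := by
  classical
  have hN := RAM.length_encode I
  set x := I.encode with hx
  obtain ⟨hD, h0⟩ := RAM.readPairs_spec I (RAM.readSizes_spec I)
  have z₁ : ∀ a, a = 0 ∨ 5 < a →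
      RAM.readPairs x (RAM.readSizes x fun _ _ _ _ => 0) a = fun _ _ _ => 0 := by
    rintro a (rfl | ha)
    · rw [RAM.readPairs_array (by decide) (by decide) (by decide),
        RAM.readSizes_array (by decide) (by decide) (by decide)]
    · exact h0 a ha
  simp only [RAM.algorithm, RAM.thn_apply]
  set σ₁ := RAM.readPairs x (RAM.readSizes x fun _ _ _ _ => 0) with hσ₁
  set K : ℕ → ℕ := fun v => r1 x σ₁ 3 v with hKdef
  set A : ℕ → ℕ → ℕ := fun u v => r2 x σ₁ 4 u v with hAdef
  have F₁ : RAM.Fixed x n K A (RAM.rel x σ₁) σ₁ :=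
    ⟨hD.num, fun _ => rfl, fun _ _ => rfl, fun _ _ _ _ => rfl⟩
  have hKk : ∀ v (hv : v < n), K v = k ⟨v, hv⟩ := fun v hv => hD.size ⟨v, hv⟩
  have hAG : ∀ u v (hu : u < n) (hv : v < n),
      A u v = if I.graph.Adj ⟨u, hu⟩ ⟨v, hv⟩ then 1 else 0 :=
    fun u v hu hv => hD.adj ⟨u, hu⟩ ⟨v, hv⟩
  have hK : ∀ v < n, 0 < K v ∧ K v ≤ x.length := fun v hv => by
    rw [hKk v hv]
    exact ⟨hk _, RAM.alphabet_le_length I _⟩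
  have hA₁ : ∀ u < n, ∀ v < n, A u v ≤ 1 := fun u hu v hv => by
    rw [hAG u v hu hv]
    split_ifs <;> omega
  have hAd : ∀ u < n, A u u = 0 := fun u hu => by
    rw [hAG u u hu hu, if_neg (I.graph.loopless.irrefl _)]
  have hA : ∀ u < n, ∀ v < n, A u v = A v u := fun u hu v hv => by
    rw [hAG u v hu hv, hAG v u hv hu]
    simp only [I.graph.adj_comm]
  have hR : ∀ u < n, ∀ v < n, 0 < A u v → ∀ a < K u, ∀ b < K v,
      RAM.rel x σ₁ u v a b = RAM.rel x σ₁ v u b a := by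
    intro u hu v hv huv a ha b hb
    rw [hKk u hu] at ha
    rw [hKk v hv] at hb
    have hadj : I.graph.Adj ⟨u, hu⟩ ⟨v, hv⟩ := by
      by_contra h
      rw [hAG u v hu hv, if_neg h] at huv
      omega
    have e₁ := hD.rel ⟨u, hu⟩ ⟨v, hv⟩ hadj ⟨a, ha⟩ ⟨b, hb⟩
    have e₂ := hD.rel ⟨v, hv⟩ ⟨u, hu⟩ hadj.symm ⟨b, hb⟩ ⟨a, ha⟩
    exact e₁.trans ((if_congr (I.rel_symm hadj _ _) rfl rfl).trans e₂.symm)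
  have hdeg : ∀ u < n, ∑ w ∈ Finset.range n, A u w ≤ d := by
    intro u hu
    have h := hd ⟨u, hu⟩
    rw [Set.encard_eq_coe_toFinset_card, Nat.cast_le] at h
    refine Eq.trans_le ?_ h
    rw [Finset.sum_range, Finset.sum_congr rfl fun (w : Fin n) _ => hAG u w hu w.2,
      ← Finset.card_filter]
    congr 1
    ext w
    simp
  have b₂ : ∀ a, a ≠ 6 → RAM.colourArcs x σ₁ a = σ₁ a := fun a ha => RAM.colourArcs_array ha
  obtain ⟨hC, hpos⟩ := RAM.colourArcs_spec (by omega) F₁ (z₁ 6 (by omega)) hA₁ hAd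
  set σ₂ := RAM.colourArcs x σ₁
  have F₂ : RAM.Fixed x n K A (RAM.rel x σ₁) σ₂ := by
    refine F₁.of_eq ?_ ?_ ?_ ?_ <;> exact b₂ _ (by decide)
  have z₂ : ∀ a, a = 0 ∨ 6 < a → σ₂ a = fun _ _ _ => 0 := fun a ha => by
    rw [b₂ a (by omega), z₁ a (by omega)]
  -- Initially the all-zero assignment is stored, with value `0`. It is admissible because alphabets
  -- are nonempty, and it is what gets output if no colour class improves on it.
  have hb : RAM.BestStored x n K A (RAM.rel x σ₁) σ₂ := by
    refine ⟨fun v hv => ?_, ?_⟩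
    · simpa only [RAM.State.rd, z₂ 0 (Or.inl rfl)] using (hK v hv).1
    · simp only [RAM.State.rd, z₂ 12 (by omega)]
      exact Nat.zero_le _
  obtain ⟨g₁, g₂, g₃⟩ :=
    RAM.treatColours_spec hN F₂ hC hpos hb hK hAd hA₁ hA hR hdeg rfl
  rw [F₂.num]
  set σ' := RAM.forTo x.length n (RAM.treatColour x) σ₂
  have n' : r0 x σ' 1 = n := by rw [RAM.State.rd_congr g₂, F₂.num]
  refine ⟨fun v => ⟨_, hKk v v.2 ▸ g₁ v v.2⟩, ?_, fun v => ?_, fun ψ' => ?_⟩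
  · rw [n']
    simp [RAM.State.wr]
  · have hv : (v : ℕ) + 1 ≤ x.length := by omega
    simp [RAM.State.wr, RAM.State.rd, hv]
  · have h := g₃ (fun v => if hv : v < n then ψ' ⟨v, hv⟩ else 0) fun v hv => by
      rw [dif_pos hv, hKk v hv]
      exact (ψ' _).2
    have e₁ := I.two_mul_ncard_eq_arcValue hD ψ'
      (fun v => if hv : v < n then ψ' ⟨v, hv⟩ else 0) fun v => dif_pos v.2
    have e₂ := I.two_mul_ncard_eq_arcValue hD (fun v => ⟨_, hKk v v.2 ▸ g₁ v v.2⟩)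
      (fun v => σ'.rd x.length 0 0 0 (v + 1)) fun _ => rfl
    -- Both arc counts are twice the edge counts; the common factor `2` cancels.
    rw [← e₁, ← e₂, mul_left_comm (d + 1)] at h
    exact Nat.le_of_mul_le_mul_left h two_pos

end TwoCSP

/-- There are one program and one polynomial that serve all degree bounds `d`. -/
theorem mainTheorem8 :
    ∃ (P : RAM.Prog) (q : Polynomial ℕ),
      ∀ (d n : ℕ) (k : Fin n → ℕ), (∀ v, 0 < k v) →
        ∀ I : TwoCSP (Fin n) (fun v => Fin (k v)), I.IsBoundedDegree d →
          ∃ ψ : (∀ v : Fin n, Fin (k v)),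
            RAM.OutputsWithin P I.encode (q.eval I.encode.length)
              (List.ofFn fun v => (ψ v : ℕ)) ∧
            I.val ≤ ((d : ℝ) + 1) / 2 * I.assignmentVal ψ := by
  obtain ⟨P, q, h⟩ := RAM.algorithm_comp.exists_prog
  refine ⟨P, q, fun d n k hk I hd => ?_⟩
  obtain ⟨ψ, h₀, h₁, h₂⟩ := I.algorithm_spec hk hd
  have hN := RAM.length_encode I
  refine ⟨ψ, h _ n _ (by omega) h₀ h₁, ?_⟩
  have : Nonempty (∀ v, Fin (k v)) := ⟨ψ⟩
  refine ciSup_le fun ψ' => ?_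
  rw [TwoCSP.assignmentVal, TwoCSP.assignmentVal, ← mul_div_assoc]
  -- Both values have the same denominator; if there are no edges, both are `0` by the convention
  -- for division by zero.
  refine div_le_div_of_nonneg_right ?_ (Nat.cast_nonneg _)
  have h₃ : 2 * ((I.satisfied ψ').ncard : ℝ) ≤ ((d : ℝ) + 1) * (I.satisfied ψ).ncard := by
    exact_mod_cast h₂ ψ'
  linarith
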